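/- **Auslander's defect formula for exact categories.** Let $k$ be a commutative artinian ring, let $\check k$ be a minimal injective cogenerator over $k$, and let $D=\operatorname{Hom}_k(-,\check k)$. Let $\mathcal C$ be a $k$-linear Hom-finite Krull–Schmidt exact category (in the sense of Quillen and Keller). Write $\operatorname{Ext}(X,Y)$ for the $k$-module (under Baer sum) of equivalence classes of conflations $Y\to E\to X$; for such a class $\xi$ let $\xi.f$ and $g.\xi$ denote its pullback along $f$ and its pushout along $g$. A morphism $f$ is *projectively trivial* if $\operatorname{Ext}(f,Z)=0$ for all $Z$, and *injectively trivial* if $\operatorname{Ext}(Z,f)=0$ for all $Z$. Let $\underline{\mathcal C}$ (resp. $\overline{\mathcal C}$) be the quotient of $\mathcal C$ by the ideal of projectively (resp. injectively) trivial morphisms. Let $\mathcal C_r$ be the full subcategory of those $X\in\mathcal C$ for which the functor $D\operatorname{Ext}(X,-)$ on $\overline{\mathcal C}$ is representable, and let $\mathcal C_l$ be the full subcategory of those $X\in\mathcal C$ for which the functor $D\operatorname{Ext}(-,X)$ on $\underline{\mathcal C}$ is representable. For $K\in\mathcal C_r$ choose an object $\tau K$ and an isomorphism $\operatorname{Hom}_{\overline{\mathcal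 C}}(-,\tau K)\cong D\operatorname{Ext}(K,-)$; for $K\in\mathcal C_l$ choose an object $\tau^-K$ and an isomorphism $\operatorname{Hom}_{\underline{\mathcal C}}(\tau^-K,-)\cong D\operatorname{Ext}(-,K)$. Let $\tau$ and $\tau^-$ act on morphisms in the unique way that makes these isomorphisms natural in $K$; so $\tau$ is a functor on the image $\underline{\mathcal C_r}$ of $\mathcal C_r$ in $\underline{\mathcal C}$ with values in $\overline{\mathcal C}$, and $\tau^-$ is a functor on the image $\overline{\mathcal C_l}$ of $\mathcal C_l$ in $\overline{\mathcal C}$ with values in $\underline{\mathcal C}$. For a conflation $\xi\colon X\xrightarrow{i}E\xrightarrow{d}Y$ define the covariant and the contravariant defect by $$\xi_*(K)=\operatorname{Coker}\bigl(\operatorname{Hom}(E,K)\xrightarrow{\,-\circ i\,}\operatorname{Hom}(X,K)\bigr),\qquad \xi^*(K)=\operatorname{Coker}\bigl(\operatorname{Hom}(K,E)\xrightarrow{\,d\circ-\,}\operatorname{Hom}(K,Y)\bigr),$$ which induce functors on $\overline{\mathcal C}$ and on $\underline{\mathcal C}^{\mathrm{op}}$, respectively. Then the following hold. 1. There are $k$-linear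 isomorphisms $\xi_*(\tau K)\cong D\,\xi^*(K)$ for all conflations $\xi$ in $\mathcal C$ and all $K\in\mathcal C_r$, natural in $\xi$ (with respect to morphisms of conflations) and in $K\in\underline{\mathcal C_r}$. 2. There are $k$-linear isomorphisms $\xi^*(\tau^-K)\cong D\,\xi_*(K)$ for all conflations $\xi$ in $\mathcal C$ and all $K\in\mathcal C_l$, natural in $\xi$ (with respect to morphisms of conflations) and in $K\in\overline{\mathcal C_l}$. -/

import Mathlib

open CategoryTheory CategoryTheory.Limits Opposite

universe v u w

noncomputable section

namespace AuslanderDefect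

attribute [local instance] hasBinaryBiproducts_of_finite_biproducts

/-! ### Exact categories -/

section ConflationPredicates

variable {C : Type u} [Category.{v} C] [Preadditive C]

/-- `d` is the second map of a pair belonging to `P`. -/
def IsDeflationFor (P : ObjectProperty (ShortComplex C)) {E Y : C} (d : E ⟶ Y) : Prop :=
  ∃ (X : C) (i : X ⟶ E) (h : i ≫ d = 0), P (ShortComplex.mk i d h)

/-- `i` is the first map of a pair belonging to `P`. -/
def IsInflationFor (P : ObjectProperty (ShortComplex C)) {X E : C} (i : X ⟶ E) : Prop :=
  ∃ (Y : C) (d : E ⟶ Y) (h : i ≫ d = 0), P (ShortComplex.mk i d h)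

end ConflationPredicates

/-- An exact category in the sense of Quillen and Keller: an additive category with a class of
kernel-cokernel pairs `X ⟶ E ⟶ Y` (the conflations), closed under isomorphism, such that the zero
pair is a conflation, deflations and inflations compose, deflations admit base change
along arbitrary morphisms, and inflations admit cobase change. -/
class ExactCategory (C : Type u) [Category.{v} C] [Preadditive C] [HasFiniteBiproducts C] where
  conflation : ObjectProperty (ShortComplex C)
  isKernel : ∀ S : ShortComplex C, conflation S → Nonempty (IsLimit (KernelFork.ofι S.f S.zero))
  isCokernel : ∀ S : ShortComplex C, conflation S →
    Nonempty (IsColimit (CokernelCofork.ofπ S.g S.zero))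
  of_iso : ∀ S T : ShortComplex C, Nonempty (S ≅ T) → conflation S → conflation T
  zero_mem : ∀ S : ShortComplex C, IsZero S.X₁ → IsZero S.X₂ → IsZero S.X₃ → conflation S
  deflation_comp : ∀ {X Y Z : C} (d : X ⟶ Y) (d' : Y ⟶ Z),
    IsDeflationFor conflation d → IsDeflationFor conflation d' →
      IsDeflationFor conflation (d ≫ d')
  inflation_comp : ∀ {X Y Z : C} (i : X ⟶ Y) (i' : Y ⟶ Z),
    IsInflationFor conflation i → IsInflationFor conflation i' →
      IsInflationFor conflation (i ≫ i')
  exists_pullback : ∀ {E Y Z : C} (d : E ⟶ Y) (f : Z ⟶ Y), IsDeflationFor conflation d →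
    ∃ (P : C) (f' : P ⟶ E) (d' : P ⟶ Z), IsPullback f' d' d f ∧ IsDeflationFor conflation d'
  exists_pushout : ∀ {X E Z : C} (i : X ⟶ E) (g : X ⟶ Z), IsInflationFor conflation i →
    ∃ (P : C) (g' : E ⟶ P) (i' : Z ⟶ P), IsPushout i g g' i' ∧ IsInflationFor conflation i'

/-- A category is Krull-Schmidt if every object is a finite direct sum of objects with local
endomorphism rings. -/
class KrullSchmidt (C : Type u) [Category.{v} C] [Preadditive C] [HasFiniteBiproducts C] :
    Prop where
  exists_decomposition : ∀ X : C, ∃ (n : ℕ) (F : Fin n → C),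
    (∀ i, IsLocalRing (End (F i))) ∧ Nonempty (X ≅ ⨁ F)

section ExactCategory

variable {C : Type u} [Category.{v} C] [Preadditive C] [HasFiniteBiproducts C] [ExactCategory C]

variable (C) in
/-- The category of conflations of `C`; morphisms are commutative diagrams. -/
abbrev Conflation : Type _ := (ExactCategory.conflation (C := C)).FullSubcategory

/-- A morphism of `C` which is the first map of a conflation. -/
abbrev IsInflation {X E : C} (i : X ⟶ E) : Prop :=
  IsInflationFor (ExactCategory.conflation (C := C)) i

/-- A morphism of `C` which is the second map of a conflation. -/
abbrev IsDeflation {E Y : C} (d : E ⟶ Y) : Prop :=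
  IsDeflationFor (ExactCategory.conflation (C := C)) d

/-- Conflations `X ⟶ E ⟶ Y` with fixed end terms: extensions of `Y` by `X`. -/
structure Extension (Y X : C) where
  E : C
  i : X ⟶ E
  d : E ⟶ Y
  w : i ≫ d = 0
  mem : ExactCategory.conflation (ShortComplex.mk i d w)

namespace Extension

variable {X Y Z W : C}

/-- The extension underlying a conflation. -/
def ofConflation (ξ : Conflation C) : Extension ξ.obj.X₃ ξ.obj.X₁ :=
  ⟨ξ.obj.X₂, ξ.obj.f, ξ.obj.g, ξ.obj.zero, ξ.property⟩

lemma isDeflation (a : Extension Y X) : IsDeflation a.d := ⟨_, _, _, a.mem⟩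

lemma isInflation (a : Extension Y X) : IsInflation a.i := ⟨_, _, _, a.mem⟩

lemma exists_lift (a : Extension Y X) {T : C} (t : T ⟶ a.E) (h : t ≫ a.d = 0) :
    ∃ s : T ⟶ X, s ≫ a.i = t := by
  obtain ⟨l⟩ := ExactCategory.isKernel _ a.mem
  exact ⟨l.lift (KernelFork.ofι t h), l.fac (KernelFork.ofι t h) WalkingParallelPair.zero⟩

lemma exists_desc (a : Extension Y X) {T : C} (t : a.E ⟶ T) (h : a.i ≫ t = 0) :
    ∃ s : Y ⟶ T, a.d ≫ s = t := by
  obtain ⟨l⟩ := ExactCategory.isCokernel _ a.mem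
  exact ⟨l.desc (CokernelCofork.ofπ t h), l.fac (CokernelCofork.ofπ t h) WalkingParallelPair.one⟩

lemma mono_i (a : Extension Y X) : Mono a.i := by
  obtain ⟨l⟩ := ExactCategory.isKernel _ a.mem
  exact mono_of_isLimit_fork l

lemma epi_d (a : Extension Y X) : Epi a.d := by
  obtain ⟨l⟩ := ExactCategory.isCokernel _ a.mem
  exact epi_of_isColimit_cofork l

end Extension

/-- A deflation together with a kernel of it is a conflation. -/
lemma conflation_of_deflation {X E Y : C} (i : X ⟶ E) (d : E ⟶ Y) (w : i ≫ d = 0)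
    (hd : IsDeflation d) [Mono i] (h : ∀ {T : C} (t : T ⟶ E), t ≫ d = 0 → ∃ s, s ≫ i = t) :
    ExactCategory.conflation (ShortComplex.mk i d w) := by
  obtain ⟨X', i', w', hc⟩ := hd
  let a : Extension Y X' := ⟨E, i', d, w', hc⟩
  obtain ⟨s, hs⟩ := h i' w'
  obtain ⟨t, ht⟩ := a.exists_lift i w
  change t ≫ i' = i at ht
  have : Mono i' := a.mono_i
  refine ExactCategory.of_iso (ShortComplex.mk i' d w') _
    ⟨ShortComplex.isoMk ⟨s, t, ?_, ?_⟩ (Iso.refl _) (Iso.refl _) ?_ ?_⟩ hc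
  · rw [← cancel_mono i', Category.assoc, ht, hs, Category.id_comp]
  · rw [← cancel_mono i, Category.assoc, hs, ht, Category.id_comp]
  · simp [hs]
  · simp

/-- An inflation together with a cokernel of it is a conflation. -/
lemma conflation_of_inflation {X E Y : C} (i : X ⟶ E) (d : E ⟶ Y) (w : i ≫ d = 0)
    (hi : IsInflation i) [Epi d] (h : ∀ {T : C} (t : E ⟶ T), i ≫ t = 0 → ∃ s, d ≫ s = t) :
    ExactCategory.conflation (ShortComplex.mk i d w) := by
  obtain ⟨Y', d', w', hc⟩ := hi
  let a : Extension Y' X := ⟨E, i, d', w', hc⟩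
  obtain ⟨s, hs⟩ := h d' w'
  obtain ⟨t, ht⟩ := a.exists_desc d w
  change d' ≫ t = d at ht
  have : Epi d' := a.epi_d
  refine ExactCategory.of_iso (ShortComplex.mk i d' w') _
    ⟨ShortComplex.isoMk (Iso.refl _) (Iso.refl _) ⟨t, s, ?_, ?_⟩ ?_ ?_⟩ hc
  · rw [← cancel_epi d', ← Category.assoc, ht, hs, Category.comp_id]
  · rw [← cancel_epi d, ← Category.assoc, hs, ht, Category.comp_id]
  · simp
  · simp [ht]

namespace Extension

variable {X Y Z W : C}

/-- Two extensions are equivalent if there is an isomorphism of the middle terms which is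
compatible with the identities of the end terms. -/
def Equivalent (a b : Extension Y X) : Prop :=
  ∃ e : a.E ≅ b.E, a.i ≫ e.hom = b.i ∧ e.hom ≫ b.d = a.d

instance setoid (Y X : C) : Setoid (Extension Y X) where
  r := Equivalent
  iseqv :=
    { refl := fun a => ⟨Iso.refl _, by simp, by simp⟩
      symm := by
        rintro a b ⟨e, h₁, h₂⟩
        exact ⟨e.symm, by simp [← h₁], by simp [← h₂]⟩
      trans := by
        rintro a b c ⟨e, h₁, h₂⟩ ⟨e', h₃, h₄⟩
        exact ⟨e ≪≫ e', by simp [reassoc_of% h₁, h₃], by simp [h₄, h₂]⟩ }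

/-- The short five lemma. -/
lemma equivalent_of_hom (a b : Extension Y X) (e : a.E ⟶ b.E) (h₁ : a.i ≫ e = b.i)
    (h₂ : e ≫ b.d = a.d) : Equivalent a b := by
  have := a.mono_i
  have := b.mono_i
  have := a.epi_d
  have := b.epi_d
  have he : Mono e := by
    refine Preadditive.mono_of_cancel_zero _ fun {T} t ht => ?_
    obtain ⟨s, rfl⟩ := a.exists_lift t (by rw [← h₂, reassoc_of% ht, zero_comp])
    have : s ≫ b.i = 0 := by rw [← h₁, ← Category.assoc, ht]
    rw [zero_of_comp_mono b.i this, zero_comp]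
  obtain ⟨P, p, q, hP, Q, j, w, hq⟩ := ExactCategory.exists_pullback a.d b.d a.isDeflation
  let c : Extension b.E Q := ⟨P, j, q, w, hq⟩
  obtain ⟨l, hl⟩ := b.exists_lift (p ≫ e - q) (by simp [h₂, hP.w])
  have hv : (p - l ≫ a.i) ≫ e = q := by simp [h₁, hl]
  obtain ⟨f, hf⟩ := c.exists_desc (p - l ≫ a.i) (by
    rw [← cancel_mono e, Category.assoc, zero_comp]
    exact (congrArg (j ≫ ·) hv).trans w)
  change q ≫ f = _ at hf
  have : Epi q := c.epi_d
  have h3 : f ≫ e = 𝟙 _ := by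
    rw [← cancel_epi q, ← Category.assoc, hf, hv, Category.comp_id]
  have h4 : e ≫ f = 𝟙 _ := by
    rw [← cancel_mono e, Category.assoc, h3, Category.comp_id, Category.id_comp]
  exact ⟨⟨e, f, h4, h3⟩, h₁, h₂⟩

lemma exists_pull (a : Extension Y X) (f : Z ⟶ Y) :
    ∃ (b : Extension Z X) (p : b.E ⟶ a.E), b.i ≫ p = a.i ∧ IsPullback p b.d a.d f := by
  obtain ⟨P, p, q, hP, hq⟩ := ExactCategory.exists_pullback a.d f a.isDeflation
  have := a.mono_i
  let i : X ⟶ P := hP.lift a.i 0 (by simp [a.w])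
  have hip : i ≫ p = a.i := hP.lift_fst ..
  have : Mono (i ≫ p) := by rw [hip]; infer_instance
  have : Mono i := mono_of_mono i p
  refine ⟨⟨P, i, q, hP.lift_snd .., conflation_of_deflation _ _ _ hq fun t ht => ?_⟩, p, hip, hP⟩
  obtain ⟨s, hs⟩ := a.exists_lift (t ≫ p) (by rw [Category.assoc, hP.w, reassoc_of% ht, zero_comp])
  refine ⟨s, hP.hom_ext (by simp [hip, hs]) ?_⟩
  rw [ht, Category.assoc, hP.lift_snd, comp_zero]

lemma exists_push (a : Extension Y X) (g : X ⟶ Z) :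
    ∃ (b : Extension Y Z) (p : a.E ⟶ b.E), p ≫ b.d = a.d ∧ IsPushout a.i g p b.i := by
  obtain ⟨P, p, q, hP, hq⟩ := ExactCategory.exists_pushout a.i g a.isInflation
  have := a.epi_d
  let d : P ⟶ Y := hP.desc a.d 0 (by simp [a.w])
  have hip : p ≫ d = a.d := hP.inl_desc ..
  have : Epi (p ≫ d) := by rw [hip]; infer_instance
  have : Epi d := epi_of_epi p d
  refine ⟨⟨P, q, d, hP.inr_desc .., conflation_of_inflation _ _ _ hq fun t ht => ?_⟩, p, hip, hP⟩
  obtain ⟨s, hs⟩ := a.exists_desc (p ≫ t) (by rw [← Category.assoc, hP.w, Category.assoc, ht,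
    comp_zero])
  refine ⟨s, hP.hom_ext (by rw [← Category.assoc, hip, hs]) ?_⟩
  rw [ht, ← Category.assoc, hP.inr_desc, zero_comp]

/-- The pullback `ξ.f` of an extension along `f`. -/
def pull (f : Z ⟶ Y) (a : Extension Y X) : Extension Z X := (a.exists_pull f).choose

/-- The pushout `g.ξ` of an extension along `g`. -/
def push (g : X ⟶ Z) (a : Extension Y X) : Extension Y Z := (a.exists_push g).choose

/-- The canonical map from the middle term of `ξ.f` to the middle term of `ξ`. -/
def pullHom (f : Z ⟶ Y) (a : Extension Y X) : (pull f a).E ⟶ a.E :=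
  (a.exists_pull f).choose_spec.choose

/-- The canonical map from the middle term of `ξ` to the middle term of `g.ξ`. -/
def pushHom (g : X ⟶ Z) (a : Extension Y X) : a.E ⟶ (push g a).E :=
  (a.exists_push g).choose_spec.choose

@[simp]
lemma i_pullHom (f : Z ⟶ Y) (a : Extension Y X) : (pull f a).i ≫ pullHom f a = a.i :=
  (a.exists_pull f).choose_spec.choose_spec.1

@[simp]
lemma i_pullHom_assoc (f : Z ⟶ Y) (a : Extension Y X) {T : C} (t : a.E ⟶ T) :
    (pull f a).i ≫ pullHom f a ≫ t = a.i ≫ t := by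
  rw [← Category.assoc, i_pullHom]

lemma isPullback_pull (f : Z ⟶ Y) (a : Extension Y X) :
    IsPullback (pullHom f a) (pull f a).d a.d f :=
  (a.exists_pull f).choose_spec.choose_spec.2

@[simp]
lemma pushHom_d (g : X ⟶ Z) (a : Extension Y X) : pushHom g a ≫ (push g a).d = a.d :=
  (a.exists_push g).choose_spec.choose_spec.1

@[simp]
lemma pushHom_d_assoc (g : X ⟶ Z) (a : Extension Y X) {T : C} (t : Y ⟶ T) :
    pushHom g a ≫ (push g a).d ≫ t = a.d ≫ t := by
  rw [← Category.assoc, pushHom_d]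

lemma isPushout_push (g : X ⟶ Z) (a : Extension Y X) :
    IsPushout a.i g (pushHom g a) (push g a).i :=
  (a.exists_push g).choose_spec.choose_spec.2

/-- A morphism of conflations `ξ ⟶ ξ'` with end components `g` and `f` yields an equivalence
between `g.ξ` and `ξ'.f`. -/
lemma push_equivalent_pull {X' Y' : C} (a : Extension Y X) (b : Extension Y' X') (g : X ⟶ X')
    (e : a.E ⟶ b.E) (f : Y ⟶ Y') (h₁ : a.i ≫ e = g ≫ b.i) (h₂ : e ≫ b.d = a.d ≫ f) :
    Equivalent (push g a) (pull f b) := by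
  have hpo := isPushout_push g a
  have hpb := isPullback_pull f b
  let s : a.E ⟶ (pull f b).E := hpb.lift e a.d h₂
  have hs₁ : s ≫ pullHom f b = e := hpb.lift_fst ..
  have hs₂ : s ≫ (pull f b).d = a.d := hpb.lift_snd ..
  have hs : a.i ≫ s = g ≫ (pull f b).i := hpb.hom_ext (by simp [hs₁, h₁])
    (by simp [hs₂, a.w, (pull f b).w])
  refine equivalent_of_hom _ _ (hpo.desc s _ hs) (hpo.inr_desc ..) (hpo.hom_ext ?_ ?_)
  · rw [← Category.assoc, hpo.inl_desc, hs₂, pushHom_d]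
  · rw [← Category.assoc, hpo.inr_desc, (pull f b).w, (push g a).w]

/-- The fibre product over `Y` of two extensions of `Y`: the conflation
`X ⊞ X' ⟶ E ×_Y E' ⟶ Y`. -/
lemma exists_fibreProduct {X' : C} (a : Extension Y X) (b : Extension Y X') :
    ∃ (c : Extension Y (X ⊞ X')) (p : c.E ⟶ a.E) (q : c.E ⟶ b.E),
      IsPullback p q a.d b.d ∧ p ≫ a.d = c.d ∧
      c.i ≫ p = biprod.fst ≫ a.i ∧ c.i ≫ q = biprod.snd ≫ b.i := by
  obtain ⟨P, p, q, hP, hq⟩ := ExactCategory.exists_pullback a.d b.d a.isDeflation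
  have hw : (biprod.fst ≫ a.i : X ⊞ X' ⟶ _) ≫ a.d = (biprod.snd ≫ b.i) ≫ b.d := by
    simp [a.w, b.w]
  let i : X ⊞ X' ⟶ P := hP.lift (biprod.fst ≫ a.i) (biprod.snd ≫ b.i) hw
  have h₁ : i ≫ p = biprod.fst ≫ a.i := hP.lift_fst ..
  have h₂ : i ≫ q = biprod.snd ≫ b.i := hP.lift_snd ..
  have := a.mono_i
  have := b.mono_i
  have hi : Mono i := by
    refine Preadditive.mono_of_cancel_zero _ fun {T} t ht => biprod.hom_ext _ _ ?_ ?_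
    · rw [← cancel_mono a.i, Category.assoc, ← h₁, reassoc_of% ht]; simp
    · rw [← cancel_mono b.i, Category.assoc, ← h₂, reassoc_of% ht]; simp
  refine ⟨⟨P, i, q ≫ b.d, ?_, conflation_of_deflation _ _ _
    (ExactCategory.deflation_comp _ _ hq b.isDeflation) fun t ht => ?_⟩, p, q, hP, hP.w, h₁, h₂⟩
  · rw [← Category.assoc, h₂, Category.assoc, b.w, comp_zero]
  · obtain ⟨s, hs⟩ := a.exists_lift (t ≫ p) (by rw [Category.assoc, hP.w, ht])
    obtain ⟨s', hs'⟩ := b.exists_lift (t ≫ q) (by rw [Category.assoc, ht])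
    exact ⟨biprod.lift s s', hP.hom_ext (by simp [h₁, hs]) (by simp [h₂, hs'])⟩

/-- The fibre product of two extensions of `Y`, as an extension of `Y` by `X ⊞ X'`. -/
def fibreProduct {X' : C} (a : Extension Y X) (b : Extension Y X') : Extension Y (X ⊞ X') :=
  (exists_fibreProduct a b).choose

/-- The first projection `E ×_Y E' ⟶ E`. -/
def fibreFst {X' : C} (a : Extension Y X) (b : Extension Y X') : (fibreProduct a b).E ⟶ a.E :=
  (exists_fibreProduct a b).choose_spec.choose

/-- The second projection `E ×_Y E' ⟶ E'`. -/
def fibreSnd {X' : C} (a : Extension Y X) (b : Extension Y X') : (fibreProduct a b).E ⟶ b.E :=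
  (exists_fibreProduct a b).choose_spec.choose_spec.choose

lemma isPullback_fibreProduct {X' : C} (a : Extension Y X) (b : Extension Y X') :
    IsPullback (fibreFst a b) (fibreSnd a b) a.d b.d :=
  (exists_fibreProduct a b).choose_spec.choose_spec.choose_spec.1

@[simp]
lemma fibreFst_d {X' : C} (a : Extension Y X) (b : Extension Y X') :
    fibreFst a b ≫ a.d = (fibreProduct a b).d :=
  (exists_fibreProduct a b).choose_spec.choose_spec.choose_spec.2.1

@[simp]
lemma fibreFst_d_assoc {X' T : C} (a : Extension Y X) (b : Extension Y X') (t : Y ⟶ T) :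
    fibreFst a b ≫ a.d ≫ t = (fibreProduct a b).d ≫ t := by
  rw [← Category.assoc, fibreFst_d]

@[simp]
lemma fibreSnd_d {X' : C} (a : Extension Y X) (b : Extension Y X') :
    fibreSnd a b ≫ b.d = (fibreProduct a b).d := by
  rw [← (isPullback_fibreProduct a b).w, fibreFst_d]

@[simp]
lemma fibreSnd_d_assoc {X' T : C} (a : Extension Y X) (b : Extension Y X') (t : Y ⟶ T) :
    fibreSnd a b ≫ b.d ≫ t = (fibreProduct a b).d ≫ t := by
  rw [← Category.assoc, fibreSnd_d]

@[simp]
lemma i_fibreFst {X' : C} (a : Extension Y X) (b : Extension Y X') :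
    (fibreProduct a b).i ≫ fibreFst a b = biprod.fst ≫ a.i :=
  (exists_fibreProduct a b).choose_spec.choose_spec.choose_spec.2.2.1

@[simp]
lemma i_fibreFst_assoc {X' T : C} (a : Extension Y X) (b : Extension Y X') (t : a.E ⟶ T) :
    (fibreProduct a b).i ≫ fibreFst a b ≫ t = biprod.fst ≫ a.i ≫ t := by
  rw [← Category.assoc, i_fibreFst, Category.assoc]

@[simp]
lemma i_fibreSnd {X' : C} (a : Extension Y X) (b : Extension Y X') :
    (fibreProduct a b).i ≫ fibreSnd a b = biprod.snd ≫ b.i :=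
  (exists_fibreProduct a b).choose_spec.choose_spec.choose_spec.2.2.2

@[simp]
lemma i_fibreSnd_assoc {X' T : C} (a : Extension Y X) (b : Extension Y X') (t : b.E ⟶ T) :
    (fibreProduct a b).i ≫ fibreSnd a b ≫ t = biprod.snd ≫ b.i ≫ t := by
  rw [← Category.assoc, i_fibreSnd, Category.assoc]

lemma conflation_biprod (X Y : C) :
    ExactCategory.conflation
      (ShortComplex.mk (biprod.inl : X ⟶ X ⊞ Y) (biprod.snd : X ⊞ Y ⟶ Y) biprod.inl_snd) := by
  obtain ⟨O, hO⟩ := HasZeroObject.zero (C := C)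
  let a : Extension O O := ⟨O, 0, 0, by simp, ExactCategory.zero_mem _ hO hO hO⟩
  obtain ⟨b, p, -, hp⟩ := a.exists_push (0 : O ⟶ X)
  obtain ⟨r, hr⟩ : ∃ r : b.E ⟶ X, b.i ≫ r = 𝟙 X :=
    ⟨hp.desc 0 (𝟙 X) (by simp), hp.inr_desc ..⟩
  obtain ⟨c, q, hq, -⟩ := b.exists_pull (0 : Y ⟶ O)
  have hc : c.i ≫ q ≫ r = 𝟙 X := by rw [← Category.assoc, hq, hr]
  obtain ⟨s, hs⟩ := c.exists_desc (𝟙 _ - (q ≫ r) ≫ c.i)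
    (by rw [Preadditive.comp_sub, ← Category.assoc, hc]; simp)
  have := c.epi_d
  have hs₁ : s ≫ c.d = 𝟙 Y := by
    rw [← cancel_epi c.d, ← Category.assoc, hs]; simp [c.w]
  have hs₂ : s ≫ q ≫ r = 0 := by
    rw [← cancel_epi c.d, ← Category.assoc, hs]
    simp only [Preadditive.sub_comp, Category.assoc, hc, Category.id_comp, Category.comp_id,
      sub_self, comp_zero]
  refine ExactCategory.of_iso (ShortComplex.mk c.i c.d c.w) _ ⟨ShortComplex.isoMk (Iso.refl _)
    ⟨biprod.lift (q ≫ r) c.d, biprod.desc c.i s, ?_, ?_⟩ (Iso.refl _) ?_ ?_⟩ c.mem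
  · simp [hs]
  · apply biprod.hom_ext' <;> apply biprod.hom_ext <;> simp [hc, c.w, hs₁, hs₂]
  · apply biprod.hom_ext <;> simp [hc, c.w]
  · simp

/-- The split extension `X ⟶ X ⊞ Y ⟶ Y`. -/
def split (Y X : C) : Extension Y X :=
  ⟨X ⊞ Y, biprod.inl, biprod.snd, biprod.inl_snd, conflation_biprod X Y⟩

end Extension

/-! ### The bifunctor `Ext` -/

variable {X Y Z W : C}

/-- The set `Ext(Y, X)` of equivalence classes of conflations `X ⟶ E ⟶ Y`. -/
def YExt (Y X : C) : Type (max u v) := _root_.Quotient (Extension.setoid Y X)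

namespace YExt

/-- The class of an extension. -/
def mk (a : Extension Y X) : YExt Y X := Quotient.mk _ a

lemma mk_surjective (x : YExt Y X) : ∃ a, mk a = x := Quotient.exists_rep x

lemma mk_eq_iff (a b : Extension Y X) : mk a = mk b ↔ Extension.Equivalent a b := Quotient.eq

lemma mk_eq_of_hom (a b : Extension Y X) (e : a.E ⟶ b.E) (h₁ : a.i ≫ e = b.i)
    (h₂ : e ≫ b.d = a.d) : mk a = mk b :=
  (mk_eq_iff _ _).2 (Extension.equivalent_of_hom a b e h₁ h₂)

lemma mk_pull_id (a : Extension Y X) : mk (a.pull (𝟙 Y)) = mk a :=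
  mk_eq_of_hom _ _ (a.pullHom (𝟙 Y)) (by simp) (by rw [(a.isPullback_pull (𝟙 Y)).w]; simp)

lemma mk_push_id (a : Extension Y X) : mk (a.push (𝟙 X)) = mk a :=
  (mk_eq_of_hom _ _ (a.pushHom (𝟙 X)) (by rw [(a.isPushout_push (𝟙 X)).w]; simp) (by simp)).symm

lemma mk_push_eq_mk_pull {X' Y' : C} (a : Extension Y X) (b : Extension Y' X') (g : X ⟶ X')
    (e : a.E ⟶ b.E) (f : Y ⟶ Y') (h₁ : a.i ≫ e = g ≫ b.i) (h₂ : e ≫ b.d = a.d ≫ f) :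
    mk (a.push g) = mk (b.pull f) :=
  (mk_eq_iff _ _).2 (Extension.push_equivalent_pull a b g e f h₁ h₂)

/-- The pullback operation `ξ ↦ ξ.f` on classes. -/
def pull (f : Z ⟶ Y) : YExt Y X → YExt Z X :=
  Quotient.lift (fun a => mk (a.pull f)) (by
    rintro a b ⟨e, h₁, h₂⟩
    rw [← mk_push_id]
    refine mk_push_eq_mk_pull _ _ _ (a.pullHom f ≫ e.hom) _ ?_ ?_
    · simp [h₁]
    · rw [Category.assoc, h₂, (a.isPullback_pull f).w])

/-- The pushout operation `ξ ↦ g.ξ` on classes. -/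
def push (g : X ⟶ Z) : YExt Y X → YExt Y Z :=
  Quotient.lift (fun a => mk (a.push g)) (by
    rintro a b ⟨e, h₁, h₂⟩
    rw [← mk_pull_id (b.push g)]
    refine mk_push_eq_mk_pull _ _ _ (e.hom ≫ b.pushHom g) _ ?_ ?_
    · rw [reassoc_of% h₁, (b.isPushout_push g).w]
    · simp [h₂])

lemma pull_mk (f : Z ⟶ Y) (a : Extension Y X) : pull f (mk a) = mk (a.pull f) := rfl

lemma push_mk (g : X ⟶ Z) (a : Extension Y X) : push g (mk a) = mk (a.push g) := rfl

/-- A morphism of conflations `ξ ⟶ ξ'` with end components `g` and `f` yields `g.ξ = ξ'.f`. -/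
lemma push_eq_pull {X' Y' : C} (a : Extension Y X) (b : Extension Y' X') (g : X ⟶ X')
    (e : a.E ⟶ b.E) (f : Y ⟶ Y') (h₁ : a.i ≫ e = g ≫ b.i) (h₂ : e ≫ b.d = a.d ≫ f) :
    push g (mk a) = pull f (mk b) :=
  mk_push_eq_mk_pull a b g e f h₁ h₂

@[simp] lemma pull_id (x : YExt Y X) : pull (𝟙 Y) x = x := by
  obtain ⟨a, rfl⟩ := mk_surjective x
  exact mk_pull_id a

@[simp] lemma push_id (x : YExt Y X) : push (𝟙 X) x = x := by
  obtain ⟨a, rfl⟩ := mk_surjective x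
  exact mk_push_id a

lemma push_eq_of_hom {X' : C} (a : Extension Y X) (b : Extension Y X') (g : X ⟶ X')
    (e : a.E ⟶ b.E) (h₁ : a.i ≫ e = g ≫ b.i) (h₂ : e ≫ b.d = a.d) :
    push g (mk a) = mk b := by
  rw [push_eq_pull a b g e (𝟙 _) h₁ (by simp [h₂]), pull_id]

lemma pull_eq_of_hom {Y' : C} (a : Extension Y X) (b : Extension Y' X) (f : Y ⟶ Y')
    (e : a.E ⟶ b.E) (h₁ : a.i ≫ e = b.i) (h₂ : e ≫ b.d = a.d ≫ f) :
    pull f (mk b) = mk a := by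
  rw [← push_eq_pull a b (𝟙 _) e f (by simp [h₁]) h₂, push_id]

lemma pull_comp (f' : W ⟶ Z) (f : Z ⟶ Y) (x : YExt Y X) :
    pull (f' ≫ f) x = pull f' (pull f x) := by
  obtain ⟨a, rfl⟩ := mk_surjective x
  refine pull_eq_of_hom _ _ _ ((a.pull f).pullHom f' ≫ a.pullHom f) (by simp) ?_
  rw [Category.assoc, (a.isPullback_pull f).w, ← Category.assoc,
    ((a.pull f).isPullback_pull f').w, Category.assoc]

lemma push_comp (g : X ⟶ Z) (g' : Z ⟶ W) (x : YExt Y X) :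
    push (g ≫ g') x = push g' (push g x) := by
  obtain ⟨a, rfl⟩ := mk_surjective x
  refine push_eq_of_hom _ _ _ (a.pushHom g ≫ (a.push g).pushHom g') ?_ (by simp)
  rw [← Category.assoc, (a.isPushout_push g).w, Category.assoc,
    ((a.push g).isPushout_push g').w, Category.assoc]

lemma push_pull (g : X ⟶ W) (f : Z ⟶ Y) (x : YExt Y X) :
    push g (pull f x) = pull f (push g x) := by
  obtain ⟨a, rfl⟩ := mk_surjective x
  refine push_eq_pull (a.pull f) (a.push g) g (a.pullHom f ≫ a.pushHom g) f ?_ ?_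
  · rw [← Category.assoc, Extension.i_pullHom, (a.isPushout_push g).w]
  · rw [Category.assoc, Extension.pushHom_d, (a.isPullback_pull f).w]

/-- A representative of a class. -/
def rep (x : YExt Y X) : Extension Y X := Quotient.out x

@[simp] lemma mk_rep (x : YExt Y X) : mk x.rep = x := Quotient.out_eq x

/-- The class in `Ext(Y, X ⊞ X')` with components `x` and `x'`. -/
def pair {X' : C} (x : YExt Y X) (x' : YExt Y X') : YExt Y (X ⊞ X') :=
  mk (x.rep.fibreProduct x'.rep)

lemma push_fst_pair {X' : C} (x : YExt Y X) (x' : YExt Y X') :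
    push biprod.fst (pair x x') = x :=
  (push_eq_of_hom _ x.rep _ (x.rep.fibreFst x'.rep) (by simp) (by simp)).trans (mk_rep x)

lemma push_snd_pair {X' : C} (x : YExt Y X) (x' : YExt Y X') :
    push biprod.snd (pair x x') = x' :=
  (push_eq_of_hom _ x'.rep _ (x.rep.fibreSnd x'.rep) (by simp) (by simp)).trans (mk_rep x')

lemma push_mk_eq_mk_iff {X' : C} (g : X ⟶ X') (a : Extension Y X) (b : Extension Y X') :
    push g (mk a) = mk b ↔ ∃ e : a.E ⟶ b.E, a.i ≫ e = g ≫ b.i ∧ e ≫ b.d = a.d := by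
  refine ⟨fun h => ?_, fun ⟨e, h₁, h₂⟩ => push_eq_of_hom a b g e h₁ h₂⟩
  obtain ⟨e, h₁, h₂⟩ := (mk_eq_iff _ _).1 h
  refine ⟨a.pushHom g ≫ e.hom, ?_, ?_⟩
  · rw [← Category.assoc, (a.isPushout_push g).w, Category.assoc, h₁]
  · rw [Category.assoc, h₂, Extension.pushHom_d]

lemma pull_mk_eq_mk_iff {Y' : C} (f : Y ⟶ Y') (a : Extension Y X) (b : Extension Y' X) :
    pull f (mk b) = mk a ↔ ∃ e : a.E ⟶ b.E, a.i ≫ e = b.i ∧ e ≫ b.d = a.d ≫ f := by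
  refine ⟨fun h => ?_, fun ⟨e, h₁, h₂⟩ => pull_eq_of_hom a b f e h₁ h₂⟩
  obtain ⟨e, h₁, h₂⟩ := (mk_eq_iff _ _).1 h
  refine ⟨e.inv ≫ b.pullHom f, ?_, ?_⟩
  · rw [← h₁]; simp
  · rw [Category.assoc, (b.isPullback_pull f).w, ← h₂]; simp

lemma push_lift {X' : C} (g : Z ⟶ X) (g' : Z ⟶ X') (x : YExt Y Z) :
    push (biprod.lift g g') x = pair (push g x) (push g' x) := by
  obtain ⟨a, rfl⟩ := mk_surjective x
  obtain ⟨e, h₁, h₂⟩ := (push_mk_eq_mk_iff g a _).1 (mk_rep (push g (mk a))).symm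
  obtain ⟨e', h₁', h₂'⟩ := (push_mk_eq_mk_iff g' a _).1 (mk_rep (push g' (mk a))).symm
  have h := (push g (mk a)).rep.isPullback_fibreProduct (push g' (mk a)).rep
  refine push_eq_of_hom _ _ _ (h.lift e e' (by rw [h₂, h₂'])) (h.hom_ext ?_ ?_) ?_
  · simp [h₁]
  · simp [h₁']
  · rw [← Extension.fibreFst_d, h.lift_fst_assoc, h₂]

/-- The Baer sum of `x` and `x'`: the pushout of their fibre product along the codiagonal. -/
instance : Add (YExt Y X) where
  add x x' := push (biprod.desc (𝟙 X) (𝟙 X)) (pair x x')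

/-- The zero element of `Ext(Y, X)` is the class of the split extension. -/
instance : Zero (YExt Y X) where
  zero := mk (Extension.split Y X)

instance : Neg (YExt Y X) where
  neg x := push (-𝟙 X) x

lemma add_def (x x' : YExt Y X) :
    x + x' = push (biprod.desc (𝟙 X) (𝟙 X)) (pair x x') := rfl

lemma zero_def : (0 : YExt Y X) = mk (Extension.split Y X) := rfl

lemma neg_def (x : YExt Y X) : -x = push (-𝟙 X) x := rfl

lemma add_push (g g' : X ⟶ Z) (x : YExt Y X) : push (g + g') x = push g x + push g' x := by
  rw [add_def, ← push_lift, ← push_comp]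
  congr 1
  simp

lemma push_add (g : X ⟶ Z) (x x' : YExt Y X) : push g (x + x') = push g x + push g x' := by
  have : biprod.desc (𝟙 X) (𝟙 X) ≫ g = biprod.fst ≫ g + biprod.snd ≫ g := by
    apply biprod.hom_ext' <;> simp
  rw [add_def, ← push_comp, this, add_push, push_comp, push_comp, push_fst_pair, push_snd_pair]

lemma pull_add (f : Z ⟶ Y) (x x' : YExt Y X) : pull f (x + x') = pull f x + pull f x' := by
  have : biprod.desc (𝟙 X) (𝟙 X) = biprod.fst + biprod.snd := by
    apply biprod.hom_ext' <;> simp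
  rw [add_def, ← push_pull, this, add_push, push_pull, push_pull, push_fst_pair, push_snd_pair]

lemma add_pull (f f' : Z ⟶ Y) (x : YExt Y X) : pull (f + f') x = pull f x + pull f' x := by
  obtain ⟨a, rfl⟩ := mk_surjective x
  obtain ⟨e, h₁, h₂⟩ := (pull_mk_eq_mk_iff f _ a).1 (mk_rep (pull f (mk a))).symm
  obtain ⟨e', h₁', h₂'⟩ := (pull_mk_eq_mk_iff f' _ a).1 (mk_rep (pull f' (mk a))).symm
  refine (push_eq_pull _ a _ (Extension.fibreFst _ _ ≫ e + Extension.fibreSnd _ _ ≫ e') _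
    ?_ ?_).symm
  · simp only [Preadditive.comp_add, Extension.i_fibreFst_assoc, Extension.i_fibreSnd_assoc, h₁,
      h₁', ← Preadditive.add_comp]
    congr 1
    apply biprod.hom_ext' <;> simp
  · simp [h₂, h₂']

@[simp] lemma zero_push (x : YExt Y X) : push (0 : X ⟶ Z) x = 0 := by
  obtain ⟨a, rfl⟩ := mk_surjective x
  refine push_eq_of_hom a (Extension.split Y Z) 0 (a.d ≫ (biprod.inr : Y ⟶ Z ⊞ Y)) ?_ ?_
  · change a.i ≫ a.d ≫ (biprod.inr : Y ⟶ Z ⊞ Y) = 0 ≫ biprod.inl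
    rw [← Category.assoc, a.w, zero_comp, zero_comp]
  · change (a.d ≫ (biprod.inr : Y ⟶ Z ⊞ Y)) ≫ biprod.snd = a.d
    simp

lemma push_eq_zero_iff (g : X ⟶ Z) (a : Extension Y X) :
    push g (mk a) = 0 ↔ ∃ h : a.E ⟶ Z, a.i ≫ h = g := by
  rw [zero_def, push_mk_eq_mk_iff]
  change (∃ e : a.E ⟶ Z ⊞ Y, a.i ≫ e = g ≫ biprod.inl ∧ e ≫ biprod.snd = a.d) ↔ _
  constructor
  · rintro ⟨e, h₁, -⟩
    exact ⟨e ≫ biprod.fst, by rw [← Category.assoc, h₁]; simp⟩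
  · rintro ⟨h, rfl⟩
    refine ⟨biprod.lift h a.d, ?_, by simp⟩
    apply biprod.hom_ext <;> simp [a.w]

lemma pull_eq_zero_iff (f : Z ⟶ Y) (a : Extension Y X) :
    pull f (mk a) = 0 ↔ ∃ h : Z ⟶ a.E, h ≫ a.d = f := by
  rw [zero_def, pull_mk_eq_mk_iff]
  change (∃ e : X ⊞ Z ⟶ a.E, biprod.inl ≫ e = a.i ∧ e ≫ a.d = biprod.snd ≫ f) ↔ _
  constructor
  · rintro ⟨e, -, h₂⟩
    exact ⟨biprod.inr ≫ e, by rw [Category.assoc, h₂]; simp⟩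
  · rintro ⟨h, rfl⟩
    refine ⟨biprod.desc a.i h, by simp, ?_⟩
    apply biprod.hom_ext' <;> simp [a.w]

@[simp] lemma zero_pull (x : YExt Y X) : pull (0 : Z ⟶ Y) x = 0 := by
  obtain ⟨a, rfl⟩ := mk_surjective x
  exact (pull_eq_zero_iff 0 a).2 ⟨0, by simp⟩

instance : AddCommGroup (YExt Y X) where
  add_assoc x y z := by
    have hx := push_fst_pair x (pair y z)
    have h := push_snd_pair x (pair y z)
    have hy := push_fst_pair y z
    have hz := push_snd_pair y z
    rw [← h, ← push_comp] at hy hz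
    generalize pair x (pair y z) = t at *
    rw [← hx, ← hy, ← hz, ← add_push, ← add_push, ← add_push, ← add_push, add_assoc]
  add_comm x y := by
    have hx := push_fst_pair x y
    have hy := push_snd_pair x y
    generalize pair x y = t at *
    rw [← hx, ← hy, ← add_push, ← add_push, add_comm]
  zero_add x := by
    conv_rhs => rw [← push_id x, ← zero_add (𝟙 X), add_push, zero_push, push_id]
  add_zero x := by
    conv_rhs => rw [← push_id x, ← add_zero (𝟙 X), add_push, zero_push, push_id]
  neg_add_cancel x := by
    conv_lhs => rw [neg_def, ← push_id x, ← push_comp, ← add_push]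
    simp
  nsmul := nsmulRec
  zsmul := zsmulRec

/-- `Ext(Y, g)` as a homomorphism. -/
def pushHom (g : X ⟶ Z) : YExt Y X →+ YExt Y Z := AddMonoidHom.mk' (push g) (push_add g)

/-- `Ext(f, X)` as a homomorphism. -/
def pullHom (f : Z ⟶ Y) : YExt Y X →+ YExt Z X := AddMonoidHom.mk' (pull f) (pull_add f)

end YExt

/-- A morphism `f : Y ⟶ Y'` is projectively trivial if `Ext(f, Z) = 0` for every object `Z`. -/
def IsProjTrivial {Y Y' : C} (f : Y ⟶ Y') : Prop :=
  ∀ (Z : C) (x : YExt Y' Z), YExt.pull f x = 0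

/-- A morphism `f : X ⟶ X'` is injectively trivial if `Ext(Z, f) = 0` for every object `Z`. -/
def IsInjTrivial {X X' : C} (f : X ⟶ X') : Prop :=
  ∀ (Z : C) (x : YExt Z X), YExt.push f x = 0

variable (C) in
/-- The congruence defining `C / I`. -/
def injRel : HomRel C := fun _ _ f g => IsInjTrivial (f - g)

variable (C) in
/-- The congruence defining `C / P`. -/
def projRel : HomRel C := fun _ _ f g => IsProjTrivial (f - g)

instance : Congruence (injRel C) where
  equivalence :=
    { refl := fun f Z x => by simp
      symm := fun {f g} h Z x => by
        have := YExt.add_push (f - g) (g - f) x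
        rwa [h Z x, zero_add, sub_add_sub_cancel, sub_self, YExt.zero_push, eq_comm] at this
      trans := fun {f g l} h h' Z x => by
        rw [← sub_add_sub_cancel f g l, YExt.add_push, h Z x, h' Z x, add_zero] }
  comp_left f g g' h Z x := by rw [← Preadditive.comp_sub, YExt.push_comp, h]
  comp_right {X Y Z f f'} g h T x := by
    rw [← Preadditive.sub_comp, YExt.push_comp, h]
    exact (YExt.pushHom g).map_zero

instance : Congruence (projRel C) where
  equivalence :=
    { refl := fun f Z x => by simp
      symm := fun {f g} h Z x => by
        have := YExt.add_pull (f - g) (g - f) x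
        rwa [h Z x, zero_add, sub_add_sub_cancel, sub_self, YExt.zero_pull, eq_comm] at this
      trans := fun {f g l} h h' Z x => by
        rw [← sub_add_sub_cancel f g l, YExt.add_pull, h Z x, h' Z x, add_zero] }
  comp_left f g g' h Z x := by
    rw [← Preadditive.comp_sub, YExt.pull_comp, h]
    exact (YExt.pullHom f).map_zero
  comp_right {X Y Z f f'} g h T x := by rw [← Preadditive.sub_comp, YExt.pull_comp, h]

variable (C) in
/-- The quotient `C / I` of `C` by the ideal of injectively trivial morphisms. -/
abbrev InjStable : Type u := CategoryTheory.Quotient (injRel C)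

variable (C) in
/-- The quotient `C / P` of `C` by the ideal of projectively trivial morphisms. -/
abbrev ProjStable : Type u := CategoryTheory.Quotient (projRel C)

instance : Preadditive (InjStable C) :=
  CategoryTheory.Quotient.preadditive _ fun X Y f₁ f₂ g₁ g₂ h h' Z x => by
    rw [add_sub_add_comm, YExt.add_push, h, h', add_zero]

instance : (CategoryTheory.Quotient.functor (injRel C)).Additive :=
  CategoryTheory.Quotient.functor_additive _ _

instance : Preadditive (ProjStable C) :=
  CategoryTheory.Quotient.preadditive _ fun X Y f₁ f₂ g₁ g₂ h h' Z x => by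
    rw [add_sub_add_comm, YExt.add_pull, h, h', add_zero]

instance : (CategoryTheory.Quotient.functor (projRel C)).Additive :=
  CategoryTheory.Quotient.functor_additive _ _

lemma IsInjTrivial.exists_factor (ξ : Conflation C) {K : C} {g : ξ.obj.X₁ ⟶ K}
    (hg : IsInjTrivial g) : ∃ h : ξ.obj.X₂ ⟶ K, ξ.obj.f ≫ h = g :=
  (YExt.push_eq_zero_iff g (Extension.ofConflation ξ)).1 (hg _ _)

lemma IsProjTrivial.exists_factor (ξ : Conflation C) {K : C} {g : K ⟶ ξ.obj.X₃}
    (hg : IsProjTrivial g) : ∃ h : K ⟶ ξ.obj.X₂, h ≫ ξ.obj.g = g :=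
  (YExt.pull_eq_zero_iff g (Extension.ofConflation ξ)).1 (hg _ _)

lemma IsInjTrivial.comp_left {f : X ⟶ Y} {g : Y ⟶ Z} (hg : IsInjTrivial g) :
    IsInjTrivial (f ≫ g) := fun T x => by rw [YExt.push_comp, hg]

lemma IsProjTrivial.comp_right {f : X ⟶ Y} {g : Y ⟶ Z} (hf : IsProjTrivial f) :
    IsProjTrivial (f ≫ g) := fun T x => by rw [YExt.pull_comp, hf]

end ExactCategory

section Linear

variable (k : Type w) [CommRing k]
variable {C : Type u} [Category.{v} C] [Preadditive C] [Linear k C] [HasFiniteBiproducts C]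
  [ExactCategory C] {X Y Z W : C}

namespace YExt

/-- The `k`-module structure on `Ext(Y, X)`, with `a • ξ = (a • 𝟙).ξ`. -/
instance : Module k (YExt Y X) where
  smul a x := push (a • 𝟙 X) x
  one_smul x := by
    change push ((1 : k) • 𝟙 X) x = x
    simp
  mul_smul a b x := by
    change push ((a * b) • 𝟙 X) x = push (a • 𝟙 X) (push (b • 𝟙 X) x)
    rw [← push_comp]
    simp [smul_smul]
  smul_zero a := by
    change push (a • 𝟙 X) (0 : YExt Y X) = 0
    rw [← zero_push (0 : YExt Y X), ← push_comp]
    simp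
  smul_add a x y := push_add _ x y
  add_smul a b x := by
    change push ((a + b) • 𝟙 X) x = push (a • 𝟙 X) x + push (b • 𝟙 X) x
    rw [add_smul, add_push]
  zero_smul x := by
    change push ((0 : k) • 𝟙 X) x = 0
    simp

lemma smul_def (a : k) (x : YExt Y X) : a • x = push (a • 𝟙 X) x := rfl

/-- `Ext(Y, g)` as a linear map. -/
@[simps]
def pushₗ (g : X ⟶ Z) : YExt Y X →ₗ[k] YExt Y Z where
  toFun := push g
  map_add' := push_add g
  map_smul' a x := by simp [smul_def, ← push_comp]

/-- `Ext(f, X)` as a linear map. -/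
@[simps]
def pullₗ (f : Z ⟶ Y) : YExt Y X →ₗ[k] YExt Z X where
  toFun := pull f
  map_add' := pull_add f
  map_smul' a x := by simp [smul_def, push_pull]

end YExt

instance : Linear k (InjStable C) :=
  CategoryTheory.Quotient.linear k _ fun a X Y f₁ f₂ h Z x => by
    rw [← smul_sub, ← Category.comp_id (a • (f₁ - f₂)), Linear.smul_comp, ← Linear.comp_smul,
      YExt.push_comp, h]
    exact (YExt.pushHom _).map_zero

instance : Linear k (ProjStable C) :=
  CategoryTheory.Quotient.linear k _ fun a X Y f₁ f₂ h Z x => by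
    rw [← smul_sub, ← Category.comp_id (a • (f₁ - f₂)), Linear.smul_comp, ← Linear.comp_smul,
      YExt.pull_comp]
    exact h _ _

/-! ### The defects of a conflation -/

/-- The covariant defect of a conflation `X ⟶ E ⟶ Y` at `K`: the cokernel of
`Hom(E, K) ⟶ Hom(X, K)`. -/
abbrev CovDefect (ξ : Conflation C) (K : C) : Type v :=
  (ξ.obj.X₁ ⟶ K) ⧸ LinearMap.range (Linear.leftComp k K ξ.obj.f)

/-- The contravariant defect of a conflation `X ⟶ E ⟶ Y` at `K`: the cokernel of
`Hom(K, E) ⟶ Hom(K, Y)`. -/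
abbrev ContraDefect (ξ : Conflation C) (K : C) : Type v :=
  (K ⟶ ξ.obj.X₃) ⧸ LinearMap.range (Linear.rightComp k K ξ.obj.g)

/-- Functoriality of the covariant defect in the object. -/
def covDefectMap (ξ : Conflation C) {K K' : C} (f : K ⟶ K') :
    CovDefect k ξ K →ₗ[k] CovDefect k ξ K' :=
  Submodule.mapQ _ _ (Linear.rightComp k _ f) (by
    rintro _ ⟨h, rfl⟩
    exact ⟨h ≫ f, by simp⟩)

/-- Functoriality of the covariant defect in the conflation. -/
def covDefectMapConf {ξ ξ' : Conflation C} (m : ξ ⟶ ξ') (K : C) :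
    CovDefect k ξ' K →ₗ[k] CovDefect k ξ K :=
  Submodule.mapQ _ _ (Linear.leftComp k K m.hom.τ₁) (by
    rintro _ ⟨h, rfl⟩
    exact ⟨m.hom.τ₂ ≫ h, by simp [m.hom.comm₁₂_assoc]⟩)

/-- Functoriality of the contravariant defect in the object. -/
def contraDefectMap (ξ : Conflation C) {K K' : C} (f : K ⟶ K') :
    ContraDefect k ξ K' →ₗ[k] ContraDefect k ξ K :=
  Submodule.mapQ _ _ (Linear.leftComp k _ f) (by
    rintro _ ⟨h, rfl⟩
    exact ⟨f ≫ h, by simp⟩)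

/-- Functoriality of the contravariant defect in the conflation. -/
def contraDefectMapConf {ξ ξ' : Conflation C} (m : ξ ⟶ ξ') (K : C) :
    ContraDefect k ξ K →ₗ[k] ContraDefect k ξ' K :=
  Submodule.mapQ _ _ (Linear.rightComp k K m.hom.τ₃) (by
    rintro _ ⟨h, rfl⟩
    exact ⟨h ≫ m.hom.τ₂, by simp [m.hom.comm₂₃]⟩)

lemma hom_ext_of_mk {M : Type v} [AddCommGroup M] [Module k M] {N : Submodule k M}
    {P : ModuleCat.{v} k} {f g : ModuleCat.of k (M ⧸ N) ⟶ P}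
    (h : ∀ m : M, f.hom (Submodule.Quotient.mk m) = g.hom (Submodule.Quotient.mk m)) : f = g :=
  ModuleCat.hom_ext (Submodule.linearMap_qext _ (LinearMap.ext h))

/-- The covariant defect `ξ_*` as a functor on `C`. -/
def preCovDefect (ξ : Conflation C) : C ⥤ ModuleCat.{v} k where
  obj K := ModuleCat.of k (CovDefect k ξ K)
  map f := ModuleCat.ofHom (covDefectMap k ξ f)
  map_id _ := hom_ext_of_mk k fun g => congrArg Submodule.Quotient.mk (Category.comp_id g)
  map_comp f f' := hom_ext_of_mk k fun g =>
    congrArg Submodule.Quotient.mk (Category.assoc g f f').symm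

/-- The covariant defect `ξ_*` as a functor on `C / I`. -/
def covDefectObj (ξ : Conflation C) : InjStable C ⥤ ModuleCat.{v} k :=
  CategoryTheory.Quotient.lift (injRel C) (preCovDefect k ξ) fun _ _ _ _ h =>
    hom_ext_of_mk k fun g => (Submodule.Quotient.eq _).2 <| by
      obtain ⟨l, hl⟩ := IsInjTrivial.exists_factor ξ (IsInjTrivial.comp_left (f := g) h)
      exact ⟨l, by simpa using hl⟩

variable (C) in
/-- The covariant defect as a functor `ξ ↦ ξ_*`. -/
def covDefect : (Conflation C)ᵒᵖ ⥤ InjStable C ⥤ ModuleCat.{v} k where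
  obj ξ := covDefectObj k ξ.unop
  map m :=
    { app := fun K => ModuleCat.ofHom (covDefectMapConf k m.unop K.as)
      naturality := by
        rintro ⟨K⟩ ⟨K'⟩ ⟨f⟩
        exact hom_ext_of_mk k fun g =>
          congrArg Submodule.Quotient.mk (Category.assoc m.unop.hom.τ₁ g f).symm }
  map_id ξ := by
    ext1; ext1 ⟨K⟩
    exact hom_ext_of_mk k fun g => congrArg Submodule.Quotient.mk (Category.id_comp g)
  map_comp m m' := by
    ext1; ext1 ⟨K⟩
    exact hom_ext_of_mk k fun g =>
      congrArg Submodule.Quotient.mk (Category.assoc m'.unop.hom.τ₁ m.unop.hom.τ₁ g)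

/-- The contravariant defect `ξ^*` as a contravariant functor on `C`. -/
def preContraDefect (ξ : Conflation C) : C ⥤ (ModuleCat.{v} k)ᵒᵖ where
  obj K := op (ModuleCat.of k (ContraDefect k ξ K))
  map f := (ModuleCat.ofHom (contraDefectMap k ξ f)).op
  map_id _ := Quiver.Hom.unop_inj <|
    hom_ext_of_mk k fun g => congrArg Submodule.Quotient.mk (Category.id_comp g)
  map_comp f f' := Quiver.Hom.unop_inj <|
    hom_ext_of_mk k fun g => congrArg Submodule.Quotient.mk (Category.assoc f f' g)

/-- The contravariant defect `ξ^*` as a functor on `C / P`. -/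
def contraDefectObj (ξ : Conflation C) : (ProjStable C)ᵒᵖ ⥤ ModuleCat.{v} k :=
  (CategoryTheory.Quotient.lift (projRel C) (preContraDefect k ξ) fun _ _ _ _ h =>
    Quiver.Hom.unop_inj <| hom_ext_of_mk k fun g => (Submodule.Quotient.eq _).2 <| by
      obtain ⟨l, hl⟩ := IsProjTrivial.exists_factor ξ (IsProjTrivial.comp_right (g := g) h)
      exact ⟨l, by simpa using hl⟩).leftOp

variable (C) in
/-- The contravariant defect as a functor `ξ ↦ ξ^*`. -/
def contraDefect : Conflation C ⥤ (ProjStable C)ᵒᵖ ⥤ ModuleCat.{v} k where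
  obj ξ := contraDefectObj k ξ
  map m :=
    { app := fun K => ModuleCat.ofHom (contraDefectMapConf k m K.unop.as)
      naturality := by
        rintro ⟨⟨K⟩⟩ ⟨⟨K'⟩⟩ ⟨⟨f⟩⟩
        exact hom_ext_of_mk k fun g =>
          congrArg Submodule.Quotient.mk (Category.assoc f g m.hom.τ₃) }
  map_id ξ := by
    ext1; ext1 ⟨⟨K⟩⟩
    exact hom_ext_of_mk k fun g => congrArg Submodule.Quotient.mk (Category.comp_id g)
  map_comp m m' := by
    ext1; ext1 ⟨⟨K⟩⟩
    exact hom_ext_of_mk k fun g =>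
      congrArg Submodule.Quotient.mk (Category.assoc g m.hom.τ₃ m'.hom.τ₃).symm

/-! ### Matlis duality -/

/-- `J` is an injective cogenerator: it is injective, and every nonzero element of a module is
detected by a map to `J`. -/
structure IsInjectiveCogenerator (J : Type w) [AddCommGroup J] [Module k J] : Prop where
  injective : Module.Injective k J
  cogenerator : ∀ (M : Type w) [AddCommGroup M] [Module k M] (m : M), m ≠ 0 →
    ∃ f : M →ₗ[k] J, f m ≠ 0

/-- `J` is a minimal injective cogenerator: no proper submodule is an injective cogenerator. -/
structure IsMinimalInjectiveCogenerator (J : Type w) [AddCommGroup J] [Module k J] : Prop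
    extends IsInjectiveCogenerator k J where
  minimal : ∀ N : Submodule k J, IsInjectiveCogenerator k N → N = ⊤

variable (J : Type w) [AddCommGroup J] [Module k J]

/-- The duality functor `D = Hom_k(-, J)`. -/
def matlisDual : (ModuleCat.{v} k)ᵒᵖ ⥤ ModuleCat.{max v w} k where
  obj M := ModuleCat.of k (M.unop →ₗ[k] J)
  map f := ModuleCat.ofHom (LinearMap.lcomp k J f.unop.hom)

/-! ### Generalized Auslander-Reiten duality -/

/-- The functor `Ext(X, -)` on `C / I`. -/
def extObj (X : C) : InjStable C ⥤ ModuleCat.{max u v} k :=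
  CategoryTheory.Quotient.lift (injRel C)
    { obj := fun Z => ModuleCat.of k (YExt X Z)
      map := fun g => ModuleCat.ofHom (YExt.pushₗ k g)
      map_id := fun Z => by ext x; simp
      map_comp := fun g g' => by ext x; simp [YExt.push_comp] }
    (fun Z Z' g g' h => by
      ext x
      have := YExt.add_push (g - g') g' x
      rw [h X x, zero_add, sub_add_cancel] at this
      simpa using this)

/-- The map `Ext(X', -) ⟶ Ext(X, -)` induced by `f : X ⟶ X'`. -/
def extMap {X X' : C} (f : X ⟶ X') : extObj k X' ⟶ extObj k X :=
  CategoryTheory.Quotient.natTransLift _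
    { app := fun Z => ModuleCat.ofHom (YExt.pullₗ k f)
      naturality := fun Z Z' g => by
        ext x
        exact (YExt.push_pull g f x).symm }

variable (C) in
/-- The bifunctor `D Ext(X, Z)`, covariant in `X` in `C / P` and contravariant in `Z` in
`C / I`. -/
def dExt : ProjStable C ⥤ (InjStable C)ᵒᵖ ⥤ ModuleCat.{max u v w} k :=
  CategoryTheory.Quotient.lift (projRel C)
    { obj := fun X => (extObj k X).op ⋙ matlisDual k J
      map := fun f => Functor.whiskerRight (NatTrans.op (extMap k f)) (matlisDual k J)
      map_id := fun X => by
        ext ⟨⟨Z⟩⟩ φ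
        refine LinearMap.ext fun x => ?_
        exact congrArg (fun y : YExt _ Z => (show YExt _ Z →ₗ[k] J from φ) y) (YExt.pull_id x)
      map_comp := fun f f' => by
        ext ⟨⟨Z⟩⟩ φ
        refine LinearMap.ext fun x => ?_
        exact congrArg (fun y : YExt _ Z => (show YExt _ Z →ₗ[k] J from φ) y) (YExt.pull_comp f f' x) }
    (fun X X' f f' h => by
      ext ⟨⟨Z⟩⟩ φ
      refine LinearMap.ext fun x => ?_
      have := YExt.add_pull (f - f') f' x
      rw [h Z x, zero_add, sub_add_cancel] at this
      exact congrArg (fun y : YExt _ Z => (show YExt _ Z →ₗ[k] J from φ) y) this)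

section Representations

universe v₁ u₁ v₂ u₂ x

variable {A : Type u₁} [Category.{v₁} A] {B : Type u₂} [Category.{v₂} B] [Preadditive B]
  [Linear k B]

/-- A `k`-linear representation of a contravariant functor: an object `T` and a natural
isomorphism `Hom(-, T) ≃ F`. -/
structure Representation (F : Bᵒᵖ ⥤ ModuleCat.{x} k) where
  obj : B
  iso : ∀ Z : B, (Z ⟶ obj) ≃ₗ[k] F.obj (op Z)
  natural : ∀ {Z Z' : B} (f : Z' ⟶ Z) (g : Z ⟶ obj),
    iso Z' (f ≫ g) = (F.map f.op).hom (iso Z g)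

/-- A `k`-linear representation of a covariant functor: an object `T` and a natural
isomorphism `Hom(T, -) ≃ F`. -/
structure Corepresentation (F : B ⥤ ModuleCat.{x} k) where
  obj : B
  iso : ∀ Z : B, (obj ⟶ Z) ≃ₗ[k] F.obj Z
  natural : ∀ {Z Z' : B} (f : Z ⟶ Z') (g : obj ⟶ Z),
    iso Z' (g ≫ f) = (F.map f).hom (iso Z g)

/-- If `r a` is a representation of `F(a, -)` for every `a`, then `a ↦ (r a).obj` is a functor in
such a way that the isomorphisms `Hom(-, (r a).obj) ≃ F(a, -)` are natural in `a`. -/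
def representingFunctor (F : A ⥤ Bᵒᵖ ⥤ ModuleCat.{x} k) (r : ∀ a, Representation k (F.obj a)) :
    A ⥤ B where
  obj a := (r a).obj
  map {a a'} f := ((r a').iso _).symm
    (((F.map f).app (op (r a).obj)).hom ((r a).iso _ (𝟙 (r a).obj)))
  map_id a := by simp
  map_comp {a a' a''} f f' := by
    have h : ∀ {b b' : A} (f : b ⟶ b') {Z : B} (g : Z ⟶ (r b).obj),
        (F.map f).app (op Z) ((r b).iso Z g) =
          (F.obj b').map g.op ((F.map f).app _ ((r b).iso _ (𝟙 _))) := fun {b b'} f {Z} g => by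
      rw [← NatTrans.naturality_apply]
      congr 1
      simpa using (r b).natural g (𝟙 _)
    rw [LinearEquiv.symm_apply_eq, (r a'').natural, LinearEquiv.apply_symm_apply]
    refine Eq.trans ?_ (h f' _)
    rw [LinearEquiv.apply_symm_apply]
    simp

/-- If `r b` is a representation of `F(b, -)` for every `b`, then `b ↦ (r b).obj` is a functor in
such a way that the isomorphisms `Hom((r b).obj, -) ≃ F(b, -)` are natural in `b`. -/
def corepresentingFunctor (F : Aᵒᵖ ⥤ B ⥤ ModuleCat.{x} k)
    (r : ∀ a : A, Corepresentation k (F.obj (op a))) : A ⥤ B where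
  obj a := (r a).obj
  map {a a'} f := ((r a).iso _).symm
    (((F.map f.op).app (r a').obj).hom ((r a').iso _ (𝟙 (r a').obj)))
  map_id a := by simp
  map_comp {a a' a''} f f' := by
    have h : ∀ {b b' : A} (f : b ⟶ b') {Z : B} (g : (r b').obj ⟶ Z),
        (F.map f.op).app Z ((r b').iso Z g) =
          (F.obj (op b)).map g ((F.map f.op).app _ ((r b').iso _ (𝟙 _))) := fun {b b'} f {Z} g => by
      rw [← NatTrans.naturality_apply]
      congr 1
      simpa using (r b').natural g (𝟙 _)
    rw [LinearEquiv.symm_apply_eq, (r a).natural, LinearEquiv.apply_symm_apply]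
    refine Eq.trans ?_ (h f _)
    rw [LinearEquiv.apply_symm_apply]
    simp

end Representations

variable (C) in
/-- The full subcategory `C_r` of objects `X` such that `D Ext(X, -)` is representable. -/
def Cr : ObjectProperty C :=
  fun X => Nonempty (Representation k ((dExt k C J).obj ⟨X⟩))

variable (C) in
/-- The full subcategory `C_l` of objects `X` such that `D Ext(-, X)` is representable. -/
def Cl : ObjectProperty C :=
  fun X => Nonempty (Corepresentation k ((dExt k C J).flip.obj (op ⟨X⟩)))

variable (C) in
/-- The image of `C_r` in `C / P`. -/
abbrev StableCr : Type u :=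
  ObjectProperty.FullSubcategory (fun X : ProjStable C => Cr k C J X.as)

variable (C) in
/-- The image of `C_l` in `C / I`. -/
abbrev StableCl : Type u :=
  ObjectProperty.FullSubcategory (fun X : InjStable C => Cl k C J X.as)

variable (C) in
/-- The functor `τ` on the image of `C_r` in `C / P`: the object `τ K` represents `D Ext(K, -)`,
naturally in `K`. -/
def tau : StableCr k C J ⥤ InjStable C :=
  representingFunctor k (ObjectProperty.ι _ ⋙ dExt k C J) (fun K => K.property.some)

variable (C) in
/-- The functor `τ⁻` on the image of `C_l` in `C / I`: the object `τ⁻ K` represents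
`D Ext(-, K)`, naturally in `K`. -/
def tauInv : StableCl k C J ⥤ ProjStable C :=
  corepresentingFunctor k ((ObjectProperty.ι _).op ⋙ (dExt k C J).flip)
    (fun K => K.property.some)

end Linear

end AuslanderDefect
end

open AuslanderDefect

/-! A conflation `X ⟶ E ⟶ Y` gives an exact sequence `Hom(K, E) ⟶ Hom(K, Y) ⟶ Ext(K, X) ⟶ Ext(K,
E)`, so `ξ^*(K)` is the kernel of `Ext(K, X) ⟶ Ext(K, E)` (`contraDefectToExt_injective`,
`contraDefectToExt_exact`). Since `J` is injective, `D ξ^*(K)` is the cokernel of `D Ext(K, E) ⟶ D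
Ext(K, X)`. Through the isomorphism that defines `τ K`, this map becomes composition with `X ⟶ E`,
from `Hom(E, τ K)` to `Hom(X, τ K)`, both taken modulo injectively trivial morphisms. An injectively
trivial morphism out of `X` factors through the inflation `X ⟶ E`, so passing to the quotient does
not change the cokernel, which is therefore `ξ_*(τ K)`.

The linear algebra is isolated in `quotEquivDual`, applied with `A = Hom(X, τ K)`, `V = Ext(K, X)`,
`W = Ext(K, E)` and `D = ξ^*(K)`. The resulting isomorphism is an explicit pairing: the class of `g
: X ⟶ τ K` is sent to the functional taking `f : K ⟶ Y` to the value of `g` on `ξ.f`. Naturality in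
`ξ` follows from the identity `g.ξ = ξ'.f` for a morphism of conflations (`push_eq_pull_of_hom`),
and naturality in `K` from the naturality that defines `τ` on morphisms
(`iso_comp_representingFunctor_map`). The second formula is dual, with pullback and pushout
exchanged. -/

noncomputable section

namespace AuslanderDefect

/-! ### Dualizing a left exact sequence into an injective module. -/

section ExactDuality

variable {k : Type*} [CommRing k] {J A D V W : Type*} [AddCommGroup J] [Module k J]
  [AddCommGroup A] [Module k A] [AddCommGroup D] [Module k D] [AddCommGroup V] [Module k V]
  [AddCommGroup W] [Module k W]

/-- Suppose that `0 ⟶ D ⟶ V ⟶ W` is exact and that `B : A ⟶ Hom(V, J)` is surjective, with `J`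
injective. If `N` contains the kernel of `B` and is mapped by `B` onto the image of `Hom(W, J)`,
then `B` induces an isomorphism `A ⧸ N ≃ Hom(D, J)`. -/
def quotEquivDual (hJ : Module.Baer k J) (δ : D →ₗ[k] V) (hδ : Function.Injective δ)
    (p : V →ₗ[k] W) (hp : Function.Exact δ p) (B : A →ₗ[k] V →ₗ[k] J)
    (hB : Function.Surjective B) (N : Submodule k A) (hker : LinearMap.ker B ≤ N)
    (hN : N.map B = LinearMap.range (LinearMap.lcomp k J p)) :
    (A ⧸ N) ≃ₗ[k] (D →ₗ[k] J) :=
  LinearEquiv.ofBijective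
    (N.liftQ (LinearMap.lcomp k J δ ∘ₗ B) fun a ha => by
      -- The map sends `a` to `B a ∘ δ`; on `N` the functional `B a` has the form `ψ ∘ p`, and `p ∘
      -- δ = 0`.
      obtain ⟨ψ, hψ⟩ := hN.le (Submodule.mem_map_of_mem ha)
      ext x
      change B a (δ x) = 0
      rw [← hψ]
      change ψ (p (δ x)) = 0
      rw [hp.apply_apply_eq_zero, map_zero]) <| by
    constructor
    -- If `B a` vanishes on the image of `δ`, which is `ker p`, it descends to `V ⧸ ker p`. This
    -- quotient embeds in `W`, so injectivity of `J` writes `B a` as `ψ ∘ p`, which is `B n` for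
    -- some `n ∈ N`. Then `a - n` lies in `ker B`, hence in `N`.
    · rw [← LinearMap.ker_eq_bot, Submodule.ker_liftQ_eq_bot]
      intro a ha
      have h : LinearMap.ker p ≤ LinearMap.ker (B a) := fun x hx => by
        obtain ⟨y, rfl⟩ := (hp x).1 hx
        exact LinearMap.congr_fun ha y
      obtain ⟨ψ, hψ⟩ := hJ.extension_property ((LinearMap.ker p).liftQ p le_rfl)
        (LinearMap.ker_eq_bot.1 (Submodule.ker_liftQ_eq_bot _ _ _ le_rfl))
        ((LinearMap.ker p).liftQ (B a) h)
      obtain ⟨n, hn, hn'⟩ := hN.ge ⟨ψ, rfl⟩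
      have hna : a - n ∈ LinearMap.ker B := by
        rw [LinearMap.mem_ker, map_sub, sub_eq_zero, hn']
        ext x
        exact (LinearMap.congr_fun hψ (Submodule.Quotient.mk x)).symm
      simpa using N.add_mem (hker hna) hn
    -- Extend `φ` along the injection `δ`, then use that every functional on `V` is some `B a`.
    · intro φ
      obtain ⟨ψ, rfl⟩ := hJ.extension_property δ hδ φ
      obtain ⟨a, rfl⟩ := hB ψ
      exact ⟨Submodule.Quotient.mk a, rfl⟩

end ExactDuality

/-! ### The connecting maps of a conflation and the embeddings of the defects into `Ext`. -/

section Connecting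

variable (k : Type w) [CommRing k]
variable {C : Type u} [Category.{v} C] [Preadditive C] [Linear k C] [HasFiniteBiproducts C]
  [ExactCategory C] {X Y Z W : C}

namespace YExt

/-- If the pushout of `x` to `a.E` splits, then `a.i` extends to the middle term of `x`. The
extension induces a map `f` on cokernels, giving a morphism of conflations that is the identity on
`X`; hence `x` is the pullback of `a` along `f`. -/
lemma exists_pull_eq (a : Extension Y X) (x : YExt Z X) (h : push a.i x = 0) :
    ∃ f : Z ⟶ Y, pull f (mk a) = x := by
  obtain ⟨b, rfl⟩ := mk_surjective x
  obtain ⟨e, he⟩ := (push_eq_zero_iff _ _).1 h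
  obtain ⟨f, hf⟩ := b.exists_desc (e ≫ a.d) (by rw [reassoc_of% he, a.w])
  exact ⟨f, pull_eq_of_hom b a f e he hf.symm⟩

/-- Dual to `exists_pull_eq`: the splitting lifts `a.d` to the middle term of `x`, and the lift
restricts to a map `g` on kernels. -/
lemma exists_push_eq (a : Extension Y X) (x : YExt Y Z) (h : pull a.d x = 0) :
    ∃ g : X ⟶ Z, push g (mk a) = x := by
  obtain ⟨b, rfl⟩ := mk_surjective x
  obtain ⟨e, he⟩ := (pull_eq_zero_iff _ _).1 h
  obtain ⟨g, hg⟩ := b.exists_lift (a.i ≫ e) (by rw [Category.assoc, he, a.w])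
  exact ⟨g, push_eq_of_hom a b g e hg.symm he⟩

/-- The scalar action is defined by pushout on the first term. Multiplication by `a` on all three
terms is an endomorphism of a conflation, so acting by pullback on the last term gives the same
result. -/
lemma smul_pull (a : k) (f : Z ⟶ Y) (x : YExt Y X) : pull (a • f) x = a • pull f x := by
  obtain ⟨b, rfl⟩ := mk_surjective x
  rw [smul_def, push_pull, push_eq_pull b b _ (a • 𝟙 _) (a • 𝟙 _) (by simp) (by simp),
    ← pull_comp]
  simp

lemma smul_push (a : k) (g : X ⟶ Z) (x : YExt Y X) : push (a • g) x = a • push g x := by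
  rw [smul_def, ← push_comp]
  simp

end YExt

/-- The connecting homomorphism `Hom(K, Y) ⟶ Ext(K, X)` of a conflation `X ⟶ E ⟶ Y`. -/
def contraConnecting (ξ : Conflation C) (K : C) : (K ⟶ ξ.obj.X₃) →ₗ[k] YExt K ξ.obj.X₁ where
  toFun f := YExt.pull f (YExt.mk (Extension.ofConflation ξ))
  map_add' f f' := YExt.add_pull f f' _
  map_smul' a f := YExt.smul_pull k a f _

/-- The connecting homomorphism `Hom(X, K) ⟶ Ext(Y, K)` of a conflation `X ⟶ E ⟶ Y`. -/
def covConnecting (ξ : Conflation C) (K : C) : (ξ.obj.X₁ ⟶ K) →ₗ[k] YExt ξ.obj.X₃ K where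
  toFun g := YExt.push g (YExt.mk (Extension.ofConflation ξ))
  map_add' g g' := YExt.add_push g g' _
  map_smul' a g := YExt.smul_push k a g _

/-- Exactness at `Hom(K, Y)`: the pullback of `ξ` along `f` splits exactly when `f` lifts through
the deflation. -/
lemma ker_contraConnecting (ξ : Conflation C) (K : C) :
    LinearMap.ker (contraConnecting k ξ K) = LinearMap.range (Linear.rightComp k K ξ.obj.g) :=
  Submodule.ext fun f => YExt.pull_eq_zero_iff f (Extension.ofConflation ξ)

lemma ker_covConnecting (ξ : Conflation C) (K : C) :
    LinearMap.ker (covConnecting k ξ K) = LinearMap.range (Linear.leftComp k K ξ.obj.f) :=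
  Submodule.ext fun g => YExt.push_eq_zero_iff g (Extension.ofConflation ξ)

/-- The embedding `ξ^*(K) ⟶ Ext(K, X)`. -/
def contraDefectToExt (ξ : Conflation C) (K : C) : ContraDefect k ξ K →ₗ[k] YExt K ξ.obj.X₁ :=
  Submodule.liftQ _ (contraConnecting k ξ K) (ker_contraConnecting k ξ K).ge

/-- The embedding `ξ_*(K) ⟶ Ext(Y, K)`. -/
def covDefectToExt (ξ : Conflation C) (K : C) : CovDefect k ξ K →ₗ[k] YExt ξ.obj.X₃ K :=
  Submodule.liftQ _ (covConnecting k ξ K) (ker_covConnecting k ξ K).ge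

lemma contraDefectToExt_injective (ξ : Conflation C) (K : C) :
    Function.Injective (contraDefectToExt k ξ K) :=
  LinearMap.ker_eq_bot.1 (Submodule.ker_liftQ_eq_bot _ _ _ (ker_contraConnecting k ξ K).le)

lemma covDefectToExt_injective (ξ : Conflation C) (K : C) :
    Function.Injective (covDefectToExt k ξ K) :=
  LinearMap.ker_eq_bot.1 (Submodule.ker_liftQ_eq_bot _ _ _ (ker_covConnecting k ξ K).le)

/-- Together with injectivity, this identifies `ξ^*(K)` with the kernel of `Ext(K, X) ⟶ Ext(K, E)`.
-/
lemma contraDefectToExt_exact (ξ : Conflation C) (K : C) :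
    Function.Exact (contraDefectToExt k ξ K) (YExt.pushₗ k ξ.obj.f (Y := K)) := fun x => by
  constructor
  · intro h
    obtain ⟨f, hf⟩ := YExt.exists_pull_eq (Extension.ofConflation ξ) x h
    exact ⟨Submodule.Quotient.mk f, hf⟩
  · rintro ⟨y, rfl⟩
    obtain ⟨f, rfl⟩ := Submodule.Quotient.mk_surjective _ y
    change YExt.push ξ.obj.f (YExt.pull f (YExt.mk (Extension.ofConflation ξ))) = 0
    -- The pushout of `ξ` along its own inflation splits, because the identity of `E` extends that
    -- inflation.
    rw [YExt.push_pull, (YExt.push_eq_zero_iff ξ.obj.f (Extension.ofConflation ξ)).2 ⟨𝟙 _, Category.comp_id _⟩]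
    exact (YExt.pullHom f).map_zero

lemma covDefectToExt_exact (ξ : Conflation C) (K : C) :
    Function.Exact (covDefectToExt k ξ K) (YExt.pullₗ k ξ.obj.g (X := K)) := fun x => by
  constructor
  · intro h
    obtain ⟨g, hg⟩ := YExt.exists_push_eq (Extension.ofConflation ξ) x h
    exact ⟨Submodule.Quotient.mk g, hg⟩
  · rintro ⟨y, rfl⟩
    obtain ⟨g, rfl⟩ := Submodule.Quotient.mk_surjective _ y
    change YExt.pull ξ.obj.g (YExt.push g (YExt.mk (Extension.ofConflation ξ))) = 0
    -- The pullback of `ξ` along its own deflation splits, because the identity of `E` lifts that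
    -- deflation.
    rw [← YExt.push_pull, (YExt.pull_eq_zero_iff ξ.obj.g (Extension.ofConflation ξ)).2 ⟨𝟙 _, Category.id_comp _⟩]
    exact (YExt.pushHom g).map_zero

/-- The class of a conflation is natural: `g.ξ = ξ'.f` for a morphism `ξ ⟶ ξ'` with end
components `g` and `f`. -/
lemma push_eq_pull_of_hom {ξ ξ' : Conflation C} (m : ξ ⟶ ξ') :
    YExt.push m.hom.τ₁ (YExt.mk (Extension.ofConflation ξ)) =
      YExt.pull m.hom.τ₃ (YExt.mk (Extension.ofConflation ξ')) :=
  YExt.push_eq_pull _ _ _ m.hom.τ₂ _ m.hom.comm₁₂.symm m.hom.comm₂₃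

/-- On a class `f` this reads `ξ'.(τ₃ f) = (ξ'.τ₃).f = (τ₁.ξ).f = τ₁.(ξ.f)`. It turns naturality in
the conflation into a statement about pushout on `Ext`. -/
lemma contraDefectToExt_mapConf {ξ ξ' : Conflation C} (m : ξ ⟶ ξ') (K : C)
    (y : ContraDefect k ξ K) :
    contraDefectToExt k ξ' K (contraDefectMapConf k m K y) =
      YExt.push m.hom.τ₁ (contraDefectToExt k ξ K y) := by
  obtain ⟨f, rfl⟩ := Submodule.Quotient.mk_surjective _ y
  change YExt.pull (f ≫ m.hom.τ₃) (YExt.mk (Extension.ofConflation ξ')) =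
    YExt.push m.hom.τ₁ (YExt.pull f (YExt.mk (Extension.ofConflation ξ)))
  rw [YExt.push_pull, push_eq_pull_of_hom, YExt.pull_comp]

lemma covDefectToExt_mapConf {ξ ξ' : Conflation C} (m : ξ ⟶ ξ') (K : C)
    (y : CovDefect k ξ' K) :
    covDefectToExt k ξ K (covDefectMapConf k m K y) =
      YExt.pull m.hom.τ₃ (covDefectToExt k ξ' K y) := by
  obtain ⟨g, rfl⟩ := Submodule.Quotient.mk_surjective _ y
  change YExt.push (m.hom.τ₁ ≫ g) (YExt.mk (Extension.ofConflation ξ)) =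
    YExt.pull m.hom.τ₃ (YExt.push g (YExt.mk (Extension.ofConflation ξ')))
  rw [← YExt.push_pull, ← push_eq_pull_of_hom, YExt.push_comp]

lemma contraDefectToExt_map (ξ : Conflation C) {K K' : C} (f : K ⟶ K')
    (y : ContraDefect k ξ K') :
    contraDefectToExt k ξ K (contraDefectMap k ξ f y) =
      YExt.pull f (contraDefectToExt k ξ K' y) := by
  obtain ⟨g, rfl⟩ := Submodule.Quotient.mk_surjective _ y
  exact YExt.pull_comp f g (YExt.mk (Extension.ofConflation ξ))

lemma covDefectToExt_map (ξ : Conflation C) {K K' : C} (f : K ⟶ K')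
    (y : CovDefect k ξ K) :
    covDefectToExt k ξ K' (covDefectMap k ξ f y) =
      YExt.push f (covDefectToExt k ξ K y) := by
  obtain ⟨g, rfl⟩ := Submodule.Quotient.mk_surjective _ y
  exact YExt.push_comp g f (YExt.mk (Extension.ofConflation ξ))

end Connecting

section Duality

variable {k : Type w} [CommRing k] {J : Type w} [AddCommGroup J] [Module k J]
variable {C : Type u} [Category.{v} C] [Preadditive C] [Linear k C] [HasFiniteBiproducts C]
  [ExactCategory C]

/-! ### The formula for `ξ_*` at an object representing `D Ext(K, -)`. -/

namespace Representation

variable {K : ProjStable C} (r : Representation k ((dExt k C J).obj K))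

/-- The map `Hom(X, T) ⟶ D Ext(K, X)` attached to a representation `Hom(-, T) ≃ D Ext(K, -)`. -/
def pairing (X : C) : (X ⟶ r.obj.as) →ₗ[k] (YExt K.as X →ₗ[k] J) where
  toFun g := r.iso ⟨X⟩ ((Quotient.functor (injRel C)).map g)
  map_add' _ _ := (congrArg (r.iso ⟨X⟩) (Functor.map_add _)).trans (map_add (r.iso ⟨X⟩) _ _)
  map_smul' a g := map_smul (r.iso ⟨X⟩) a ((Quotient.functor (injRel C)).map g)

/-- The representing isomorphism is bijective on stable morphisms, and every stable morphism lifts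
to `C`. -/
lemma pairing_surjective (X : C) : Function.Surjective (r.pairing X) := fun ψ => by
  obtain ⟨g, hg⟩ := (r.iso ⟨X⟩).surjective ψ
  obtain ⟨g, rfl⟩ := (Quotient.functor (injRel C)).map_surjective (X := X) (Y := r.obj.as) g
  exact ⟨g, hg⟩

lemma pairing_comp {X X' : C} (f : X' ⟶ X) (g : X ⟶ r.obj.as) (x : YExt K.as X') :
    r.pairing X' (f ≫ g) x = r.pairing X g (YExt.push f x) :=
  LinearMap.congr_fun (r.natural ((Quotient.functor (injRel C)).map f)
    ((Quotient.functor (injRel C)).map g)) x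

/-- Passing from stable morphisms to morphisms of `C` introduces no kernel beyond the injectively
trivial ones. These factor through every inflation, so the defect does not see them. -/
lemma isInjTrivial_of_pairing_eq_zero {X : C} {g : X ⟶ r.obj.as} (h : r.pairing X g = 0) :
    IsInjTrivial g := by
  have h' : (Quotient.functor (injRel C)).map g = (Quotient.functor (injRel C)).map 0 := by
    rw [Functor.map_zero]
    exact (r.iso ⟨X⟩).map_eq_zero_iff.1 h
  simpa [injRel] using (Quotient.functor_map_eq_iff (injRel C) _ _).1 h'

/-- Auslander's defect formula: `ξ_*(T) ≃ D ξ^*(K)` if `T` represents `D Ext(K, -)`. -/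
def defectEquiv (hJ : Module.Baer k J) (ξ : Conflation C) :
    CovDefect k ξ r.obj.as ≃ₗ[k] (ContraDefect k ξ K.as →ₗ[k] J) :=
  quotEquivDual hJ (contraDefectToExt k ξ K.as) (contraDefectToExt_injective k ξ K.as)
    (YExt.pushₗ k ξ.obj.f) (contraDefectToExt_exact k ξ K.as) (r.pairing _)
    (r.pairing_surjective _) _
    -- The kernel of the pairing lies in the image of `Hom(E, T)`, since injectively trivial maps
    -- extend along the inflation.
    (fun g hg => by
      obtain ⟨h, hh⟩ := (r.isInjTrivial_of_pairing_eq_zero hg).exists_factor ξ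
      exact ⟨h, hh⟩)
    -- Adjointness of the pairing sends maps extending to `E` to functionals factoring through
    -- `Ext(K, E)`. Conversely, by surjectivity of the pairing at `E`, each functional on `Ext(K,
    -- E)` comes from a map `E ⟶ T`.
    (by
      ext φ
      constructor
      · rintro ⟨_, ⟨h, rfl⟩, rfl⟩
        exact ⟨r.pairing _ h, LinearMap.ext fun x => (r.pairing_comp _ h x).symm⟩
      · rintro ⟨ψ, rfl⟩
        obtain ⟨h, rfl⟩ := r.pairing_surjective _ ψ
        exact ⟨_, ⟨h, rfl⟩, LinearMap.ext fun x => r.pairing_comp _ h x⟩)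

lemma defectEquiv_mk (hJ : Module.Baer k J) (ξ : Conflation C) (g : ξ.obj.X₁ ⟶ r.obj.as)
    (y : ContraDefect k ξ K.as) :
    r.defectEquiv hJ ξ (Submodule.Quotient.mk g) y =
      r.pairing _ g (contraDefectToExt k ξ K.as y) := rfl

/-- Both sides are the pairing of `g` with the pushout along `τ₁` of the class of `y` in `Ext`. -/
lemma defectEquiv_mapConf (hJ : Module.Baer k J) {ξ ξ' : Conflation C} (m : ξ ⟶ ξ')
    (x : CovDefect k ξ' r.obj.as) (y : ContraDefect k ξ K.as) :
    r.defectEquiv hJ ξ (covDefectMapConf k m _ x) y =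
      r.defectEquiv hJ ξ' x (contraDefectMapConf k m _ y) := by
  obtain ⟨g, rfl⟩ := Submodule.Quotient.mk_surjective _ x
  rw [defectEquiv_mk, contraDefectToExt_mapConf, ← pairing_comp]
  rfl

end Representation

/-! ### The dual formula for `ξ^*` at an object corepresenting `D Ext(-, L)`. -/

namespace Corepresentation

variable {L : InjStable C} (r : Corepresentation k ((dExt k C J).flip.obj (op L)))

/-- The map `Hom(T, Y) ⟶ D Ext(Y, L)` attached to a representation `Hom(T, -) ≃ D Ext(-, L)`. -/
def pairing (Y : C) : (r.obj.as ⟶ Y) →ₗ[k] (YExt Y L.as →ₗ[k] J) where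
  toFun g := r.iso ⟨Y⟩ ((Quotient.functor (projRel C)).map g)
  map_add' _ _ := (congrArg (r.iso ⟨Y⟩) (Functor.map_add _)).trans (map_add (r.iso ⟨Y⟩) _ _)
  map_smul' a g := map_smul (r.iso ⟨Y⟩) a ((Quotient.functor (projRel C)).map g)

lemma pairing_surjective (Y : C) : Function.Surjective (r.pairing Y) := fun ψ => by
  obtain ⟨g, hg⟩ := (r.iso ⟨Y⟩).surjective ψ
  obtain ⟨g, rfl⟩ := (Quotient.functor (projRel C)).map_surjective (X := r.obj.as) (Y := Y) g
  exact ⟨g, hg⟩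

lemma pairing_comp {Y Y' : C} (g : r.obj.as ⟶ Y) (f : Y ⟶ Y') (x : YExt Y' L.as) :
    r.pairing Y' (g ≫ f) x = r.pairing Y g (YExt.pull f x) :=
  LinearMap.congr_fun (r.natural ((Quotient.functor (projRel C)).map f)
    ((Quotient.functor (projRel C)).map g)) x

lemma isProjTrivial_of_pairing_eq_zero {Y : C} {g : r.obj.as ⟶ Y} (h : r.pairing Y g = 0) :
    IsProjTrivial g := by
  have h' : (Quotient.functor (projRel C)).map g = (Quotient.functor (projRel C)).map 0 := by
    rw [Functor.map_zero]
    exact (r.iso ⟨Y⟩).map_eq_zero_iff.1 h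
  simpa [projRel] using (Quotient.functor_map_eq_iff (projRel C) _ _).1 h'

/-- Auslander's defect formula: `ξ^*(T) ≃ D ξ_*(L)` if `T` corepresents `D Ext(-, L)`. -/
def defectEquiv (hJ : Module.Baer k J) (ξ : Conflation C) :
    ContraDefect k ξ r.obj.as ≃ₗ[k] (CovDefect k ξ L.as →ₗ[k] J) :=
  quotEquivDual hJ (covDefectToExt k ξ L.as) (covDefectToExt_injective k ξ L.as)
    (YExt.pullₗ k ξ.obj.g) (covDefectToExt_exact k ξ L.as) (r.pairing _)
    (r.pairing_surjective _) _
    -- Here the kernel consists of projectively trivial maps, which lift through the deflation.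
    (fun g hg => by
      obtain ⟨h, hh⟩ := (r.isProjTrivial_of_pairing_eq_zero hg).exists_factor ξ
      exact ⟨h, hh⟩)
    (by
      ext φ
      constructor
      · rintro ⟨_, ⟨h, rfl⟩, rfl⟩
        exact ⟨r.pairing _ h, LinearMap.ext fun x => (r.pairing_comp h _ x).symm⟩
      · rintro ⟨ψ, rfl⟩
        obtain ⟨h, rfl⟩ := r.pairing_surjective _ ψ
        exact ⟨_, ⟨h, rfl⟩, LinearMap.ext fun x => r.pairing_comp h _ x⟩)

lemma defectEquiv_mk (hJ : Module.Baer k J) (ξ : Conflation C) (g : r.obj.as ⟶ ξ.obj.X₃)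
    (y : CovDefect k ξ L.as) :
    r.defectEquiv hJ ξ (Submodule.Quotient.mk g) y =
      r.pairing _ g (covDefectToExt k ξ L.as y) := rfl

lemma defectEquiv_mapConf (hJ : Module.Baer k J) {ξ ξ' : Conflation C} (m : ξ ⟶ ξ')
    (x : ContraDefect k ξ r.obj.as) (y : CovDefect k ξ' L.as) :
    r.defectEquiv hJ ξ' (contraDefectMapConf k m _ x) y =
      r.defectEquiv hJ ξ x (covDefectMapConf k m _ y) := by
  obtain ⟨g, rfl⟩ := Submodule.Quotient.mk_surjective _ x
  rw [defectEquiv_mk, covDefectToExt_mapConf, ← pairing_comp]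
  rfl

end Corepresentation

/-! ### Naturality built into the functors `τ` and `τ⁻`. -/

section RepresentingFunctor

universe v₁ u₁ v₂ u₂ x

variable {A : Type u₁} [Category.{v₁} A] {B : Type u₂} [Category.{v₂} B] [Preadditive B]
  [Linear k B]

/-- The isomorphisms `Hom(-, (r a).obj) ≃ F(a, -)` are natural in `a`. -/
lemma iso_comp_representingFunctor_map (F : A ⥤ Bᵒᵖ ⥤ ModuleCat.{x} k)
    (r : ∀ a, Representation k (F.obj a)) {a a' : A} (f : a ⟶ a') {Z : B} (g : Z ⟶ (r a).obj) :
    (r a').iso Z (g ≫ (representingFunctor k F r).map f) =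
      ((F.map f).app (op Z)).hom ((r a).iso Z g) := by
  refine ((r a').natural g _).trans ?_
  simp only [representingFunctor, LinearEquiv.apply_symm_apply]
  -- As in the Yoneda lemma, the image of `g` is the restriction along `g` of the universal element,
  -- the image of the identity.
  have h := (r a).natural g (𝟙 _)
  rw [Category.comp_id] at h
  rw [h]
  exact (NatTrans.naturality_apply (F.map f) g.op _).symm

/-- The isomorphisms `Hom((r b).obj, -) ≃ F(b, -)` are natural in `b`. -/
lemma iso_corepresentingFunctor_map_comp (F : Aᵒᵖ ⥤ B ⥤ ModuleCat.{x} k)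
    (r : ∀ a : A, Corepresentation k (F.obj (op a))) {a a' : A} (f : a ⟶ a') {Z : B}
    (g : (r a').obj ⟶ Z) :
    (r a).iso Z ((corepresentingFunctor k F r).map f ≫ g) =
      ((F.map f.op).app Z).hom ((r a').iso Z g) := by
  refine ((r a).natural g _).trans ?_
  simp only [corepresentingFunctor, LinearEquiv.apply_symm_apply]
  have h := (r a').natural g (𝟙 _)
  rw [Category.id_comp] at h
  rw [h]
  exact (NatTrans.naturality_apply (F.map f.op) g _).symm

end RepresentingFunctor

/-! ### Naturality of the defect formula in the object. -/

/-- The defect formula is natural in `K ∈ C_r`. -/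
lemma defectEquiv_tau_map (hJ : Module.Baer k J) (ξ : Conflation C) {K K' : StableCr k C J}
    (f : K ⟶ K') (x : ((covDefect k C).obj (op ξ)).obj ((tau k C J).obj K))
    (y : ((contraDefect k C).obj ξ).obj (op K'.obj)) :
    (K'.property.some.defectEquiv hJ ξ
        ((((covDefect k C).obj (op ξ)).map ((tau k C J).map f)).hom x) :
          ContraDefect k ξ K'.obj.as →ₗ[k] J) y =
      K.property.some.defectEquiv hJ ξ x ((((contraDefect k C).obj ξ).map f.hom.op).hom y) := by
  obtain ⟨g, rfl⟩ := Submodule.Quotient.mk_surjective _ x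
  have hnat := iso_comp_representingFunctor_map (k := k) (ObjectProperty.ι _ ⋙ dExt k C J)
    (fun K : StableCr k C J => K.property.some) f
    ((Quotient.functor (injRel C)).map g)
  change _ = (((dExt k C J).map f.hom).app _).hom _ at hnat
  -- The pairing and the embedding into `Ext` are defined on morphisms of `C`, so representatives of
  -- the stable morphisms `f` and `τ f` are chosen, using that the quotient functors are full.
  obtain ⟨h, hh⟩ : ∃ h : K.obj.as ⟶ K'.obj.as, (Quotient.functor (projRel C)).map h = f.hom :=
    (Quotient.functor (projRel C)).map_surjective (X := K.obj.as) (Y := K'.obj.as) f.hom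
  obtain ⟨t, ht⟩ : ∃ t : K.property.some.obj.as ⟶ K'.property.some.obj.as,
      (Quotient.functor (injRel C)).map t = (tau k C J).map f :=
    (Quotient.functor (injRel C)).map_surjective
      (X := K.property.some.obj.as) (Y := K'.property.some.obj.as) ((tau k C J).map f)
  rw [← hh] at hnat ⊢
  change K'.property.some.iso _ (_ ≫ (tau k C J).map f) = _ at hnat
  rw [← ht] at hnat ⊢
  -- Evaluating the naturality of `τ` at the class of `y` in `Ext(K', X)` leaves the pairing of `g`
  -- with the pullback of that class along `h`, which is the class of the pullback of `y`.
  refine (LinearMap.congr_fun hnat (contraDefectToExt k ξ _ y)).trans ?_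
  exact congrArg (K.property.some.pairing _ g) (contraDefectToExt_map k ξ h y).symm

/-- The defect formula is natural in `K ∈ C_l`. -/
lemma defectEquiv_tauInv_map (hJ : Module.Baer k J) (ξ : Conflation C) {K K' : StableCl k C J}
    (f : K ⟶ K') (x : ((contraDefect k C).obj ξ).obj (op ((tauInv k C J).obj K')))
    (y : ((covDefect k C).obj (op ξ)).obj K.obj) :
    (K.property.some.defectEquiv hJ ξ
        ((((contraDefect k C).obj ξ).map ((tauInv k C J).map f).op).hom x) :
          CovDefect k ξ K.obj.as →ₗ[k] J) y =
      K'.property.some.defectEquiv hJ ξ x ((((covDefect k C).obj (op ξ)).map f.hom).hom y) := by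
  obtain ⟨g, rfl⟩ := Submodule.Quotient.mk_surjective _ x
  have hnat := iso_corepresentingFunctor_map_comp (k := k)
    ((ObjectProperty.ι _).op ⋙ (dExt k C J).flip)
    (fun K : StableCl k C J => K.property.some) f
    ((Quotient.functor (projRel C)).map g)
  change _ = (((dExt k C J).flip.map f.hom.op).app _).hom _ at hnat
  obtain ⟨h, hh⟩ : ∃ h : K.obj.as ⟶ K'.obj.as, (Quotient.functor (injRel C)).map h = f.hom :=
    (Quotient.functor (injRel C)).map_surjective (X := K.obj.as) (Y := K'.obj.as) f.hom
  obtain ⟨t, ht⟩ : ∃ t : K.property.some.obj.as ⟶ K'.property.some.obj.as,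
      (Quotient.functor (projRel C)).map t = (tauInv k C J).map f :=
    (Quotient.functor (projRel C)).map_surjective
      (X := K.property.some.obj.as) (Y := K'.property.some.obj.as) ((tauInv k C J).map f)
  rw [← hh] at hnat ⊢
  change K.property.some.iso _ ((tauInv k C J).map f ≫ _) = _ at hnat
  rw [← ht] at hnat ⊢
  -- Dually, the class of `y` lies in `Ext(Y, K)` and is pushed out along `h`.
  refine (LinearMap.congr_fun hnat (covDefectToExt k ξ _ y)).trans ?_
  exact congrArg (K'.property.some.pairing _ g) (covDefectToExt_map k ξ h y).symm

end Duality

end AuslanderDefect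
end

theorem theorem3p3 {k : Type w} [CommRing k] [IsArtinianRing k]
    {J : Type w} [AddCommGroup J] [Module k J] (hJ : IsMinimalInjectiveCogenerator k J)
    {C : Type u} [Category.{v} C] [Preadditive C] [Linear k C] [HasFiniteBiproducts C]
    [ExactCategory C] [KrullSchmidt C] [∀ X Y : C, Module.Finite k (X ⟶ Y)] :
    (∃ e : ∀ (ξ : Conflation C) (K : StableCr k C J),
        ((covDefect k C).obj (op ξ)).obj ((tau k C J).obj K) ≃ₗ[k]
          (((contraDefect k C).obj ξ).obj (op K.obj) →ₗ[k] J),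
      (∀ {ξ ξ' : Conflation C} (m : ξ ⟶ ξ') (K : StableCr k C J)
          (x : ((covDefect k C).obj (op ξ')).obj ((tau k C J).obj K)),
        e ξ K ((((covDefect k C).map m.op).app ((tau k C J).obj K)).hom x) =
          e ξ' K x ∘ₗ (((contraDefect k C).map m).app (op K.obj)).hom) ∧
      (∀ (ξ : Conflation C) {K K' : StableCr k C J} (f : K ⟶ K')
          (x : ((covDefect k C).obj (op ξ)).obj ((tau k C J).obj K)),
        e ξ K' ((((covDefect k C).obj (op ξ)).map ((tau k C J).map f)).hom x) =
          e ξ K x ∘ₗ (((contraDefect k C).obj ξ).map f.hom.op).hom)) ∧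
    (∃ e : ∀ (ξ : Conflation C) (K : StableCl k C J),
        ((contraDefect k C).obj ξ).obj (op ((tauInv k C J).obj K)) ≃ₗ[k]
          (((covDefect k C).obj (op ξ)).obj K.obj →ₗ[k] J),
      (∀ {ξ ξ' : Conflation C} (m : ξ ⟶ ξ') (K : StableCl k C J)
          (x : ((contraDefect k C).obj ξ).obj (op ((tauInv k C J).obj K))),
        e ξ' K ((((contraDefect k C).map m).app (op ((tauInv k C J).obj K))).hom x) =
          e ξ K x ∘ₗ (((covDefect k C).map m.op).app K.obj).hom) ∧
      (∀ (ξ : Conflation C) {K K' : StableCl k C J} (f : K ⟶ K')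
          (x : ((contraDefect k C).obj ξ).obj (op ((tauInv k C J).obj K'))),
        e ξ K ((((contraDefect k C).obj ξ).map ((tauInv k C J).map f).op).hom x) =
          e ξ K' x ∘ₗ (((covDefect k C).obj (op ξ)).map f.hom).hom)) := by
  -- Injectivity of `J` is assumed for modules in the universe of `J`, while `Ext` lives in another
  -- one. Baer's criterion involves only ideals of `k` and yields extensions in every universe.
  have hB : Module.Baer k J := Module.Baer.of_injective hJ.injective
  -- `K.property.some` is the representation chosen in `tau`, so its representing object is `τ K` by
  -- definition; likewise for `tauInv` in the second half.
  exact ⟨⟨fun ξ K => K.property.some.defectEquiv hB ξ,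
      fun m K x => LinearMap.ext fun y => K.property.some.defectEquiv_mapConf hB m x y,
      fun ξ _ _ f x => LinearMap.ext fun y => defectEquiv_tau_map hB ξ f x y⟩,
    fun ξ K => K.property.some.defectEquiv hB ξ,
    fun m K x => LinearMap.ext fun y => K.property.some.defectEquiv_mapConf hB m x y,
    fun ξ _ _ f x => LinearMap.ext fun y => defectEquiv_tauInv_map hB ξ f x y⟩
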